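/- Let $d\ge 1$, $n_G\ge 2$, $X=[0,1]^d$, $\epsilon=1/(n_G-1)$, and let $G$ be the regular grid of the $n_G^d$ points of $X$ whose coordinates are integer multiples of $\epsilon$. Let $\mathcal M:X\to\{-1,0,+1\}$ be a classification function which does not vanish at any point of $G$ (for example, $\mathcal M=0$ on a $(d-1)$-dimensional manifold $M$ that contains no point of $G$ and separates $X$ into two parts, and $\mathcal M=-1$, resp. $+1$, on these parts). Each cube $C$ of the grid, with edges of length $\epsilon$ and lowest corner $c$, is divided into the $d!$ Kuhn simplices $$S_P=\{x\in C:\ 0\le x_{P(1)}-c_{P(1)}\le x_{P(2)}-c_{P(2)}\le\dots\le x_{P(d)}-c_{P(d)}\le\epsilon\},$$ where $P$ runs over the permutations of $\{1,\dots,d\}$. For every edge $[v_-,v_+]$ of a Kuhn simplex of the grid with $\mathcal M(v_-)=-1$ and $\mathcal M(v_+)=+1$, choose a boundary point $$b([v_-,v_+])=v_-+\tfrac{i+1/2}{n}(v_+-v_-),$$ where $n\ge1$ is an integer (which may depend on the edge) and $i\in\{0,\dots,n-1\}$ is such that $\mathcal M\big(v_-+\tfrac{i}{n}(v_+-v_-)\big)\ne+1$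 and $\mathcal M\big(v_-+\tfrac{i+1}{n}(v_+-v_-)\big)=+1$ (the outcome of $q$ successive dichotomies is of this kind, with $n=2^q$). For a face $F$ of a Kuhn simplex, let $B(F)$ be the finite set of the boundary points on the edges of $F$ and $\bar B(F)$ its barycentre. If $S$ is a Kuhn simplex with $B(S)\neq\emptyset$, its K-resistar is $$R(S)=\bigcup_{F_1\subset F_2\subset\dots\subset F_{d-1}\subset F_d=S}\mathrm{conv}\{\bar B(F_1),\dots,\bar B(F_{d-1}),\bar B(S)\},$$ the union being over all chains in which $F_i$ is an $i$-dimensional face of $S$ and $B(F_1)\ne\emptyset$; if $B(S)=\emptyset$, put $R(S)=\emptyset$. The K-resistar approximation on the grid is $R=\bigcup_S R(S)$, over all Kuhn simplices $S$ of all cubes of the grid. Then: 1. $R$ is a (possibly empty) $(d-1)$-dimensional topological manifold with boundary, and its boundary is $R\cap\partial X$: every point of $R$ has an open neighbourhood in $R$ that is homeomorphic to an open subset of the closed half-space $\{y\in\mathbb R^{d-1}: y_1\ge0\}$ (of the one-point space if $d=1$), such that exactly the points of $\partial X$ are mapped to the hyperplane $y_1=0$ (to no point if $d=1$). 2. The charts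 of the K-resistars on hyperplanes are glued consistently across shared faces: for every Kuhn simplex $S$ with $B(S)\ne\emptyset$ there are an affine hyperplane $H_S$ which strictly separates the vertices of $S$ labelled $+1$ from those labelled $-1$, and a homeomorphism $\varphi_S:R(S)\to S\cap H_S$ with $\varphi_S(R(S)\cap F)=F\cap H_S$ for every face $F$ of $S$, such that, for any two such Kuhn simplices $S,S'$, $\varphi_S=\varphi_{S'}$ on $R(S)\cap R(S')$. Moreover $R(S)\cap S'=R(S')\cap S$ for any two Kuhn simplices $S,S'$ of the grid. -/

import Mathlib

/-- Euclidean space `ℝ^d`. -/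
abbrev Pt (d : ℕ) : Type := EuclideanSpace ℝ (Fin d)

/-- The compact set `X = [0,1]^d`. -/
def unitCube (d : ℕ) : Set (Pt d) := {x | ∀ i, 0 ≤ x i ∧ x i ≤ 1}

/-- The mesh `ε = 1 / (n_G - 1)` of the regular grid with `n_G` points on each axis. -/
noncomputable def gridStep (nG : ℕ) : ℝ := 1 / ((nG : ℝ) - 1)

/-- The point of the grid with integer coordinates `m`; the points of the grid are
those with `m i < n_G` for all `i`. -/
noncomputable def gridPoint {d : ℕ} (nG : ℕ) (m : Fin d → ℕ) : Pt d :=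
  WithLp.toLp 2 (fun i => (m i : ℝ) * gridStep nG)

/-- The K-simplex `S_P` of the cube with lowest corner `gridPoint nG k`: the points of this cube
such that `0 ≤ y (P 1) ≤ y (P 2) ≤ … ≤ y (P d) ≤ ε`, where `y = x - gridPoint nG k` is the position
relative to the lowest corner of the cube. -/
def kuhnSimplex {d : ℕ} (nG : ℕ) (k : Fin d → ℕ) (P : Equiv.Perm (Fin d)) : Set (Pt d) :=
  {x | (∀ i, gridPoint nG k i ≤ x i ∧ x i ≤ gridPoint nG k i + gridStep nG) ∧
    ∀ i j, i ≤ j →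
      x (P i) - gridPoint nG k (P i) ≤ x (P j) - gridPoint nG k (P j)}

/-- The `j`-th vertex (`0 ≤ j ≤ d`) of the K-simplex `S_P`: its coordinates of indices
`P 1, …, P j` are the lowest ones in the cube, its other coordinates are the highest ones. -/
noncomputable def kuhnVertex {d : ℕ} (nG : ℕ) (k : Fin d → ℕ) (P : Equiv.Perm (Fin d))
    (j : Fin (d + 1)) : Pt d :=
  gridPoint nG (fun i => k i + if (j : ℕ) ≤ (P.symm i : ℕ) then 1 else 0)

open Classical in
/-- The set of vertices of the K-simplex `S_P`. -/
noncomputable def kuhnVertices {d : ℕ} (nG : ℕ) (k : Fin d → ℕ) (P : Equiv.Perm (Fin d)) :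
    Finset (Pt d) :=
  Finset.univ.image (kuhnVertex nG k P)

/-- The K-simplex `S_P` is the convex hull of its vertices. -/
theorem convexHull_kuhnVertices {d : ℕ} (nG : ℕ) (hnG : 2 ≤ nG) (k : Fin d → ℕ)
    (P : Equiv.Perm (Fin d)) :
    convexHull ℝ (kuhnVertices nG k P : Set (Pt d)) = kuhnSimplex nG k P := by
  have hε : 0 < gridStep nG := by
    unfold gridStep
    have : (2 : ℝ) ≤ nG := by exact_mod_cast hnG
    apply one_div_pos.2
    linarith
  apply Set.Subset.antisymm
  · apply convexHull_min
    · intro x hx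
      simp only [kuhnVertices, Finset.coe_image, Finset.coe_univ, Set.image_univ,
        Set.mem_range] at hx
      obtain ⟨j, rfl⟩ := hx
      refine ⟨fun i => ?_, fun i i' hi => ?_⟩
      · simp only [kuhnVertex, gridPoint]
        split_ifs <;> push_cast <;> constructor <;> nlinarith
      · simp only [kuhnVertex, gridPoint, Equiv.symm_apply_apply]
        have : (i : ℕ) ≤ i' := hi
        split_ifs
        · push_cast; nlinarith
        · omega
        · push_cast; nlinarith
        · push_cast; nlinarith
    · intro x hx y hy a b ha hb hab
      have hb' : b = 1 - a := by linarith
      subst hb'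
      refine ⟨fun i => ?_, fun i j hij => ?_⟩
      · have h1 := hx.1 i
        have h2 := hy.1 i
        simp only [PiLp.add_apply, PiLp.smul_apply, smul_eq_mul]
        constructor <;> nlinarith
      · have h1 := hx.2 i j hij
        have h2 := hy.2 i j hij
        simp only [PiLp.add_apply, PiLp.smul_apply, smul_eq_mul]
        nlinarith
  · intro x hx
    obtain ⟨h1, h2⟩ := hx
    -- `g m` is the `m`-th relative coordinate in increasing order, between `g 0 = 0` and `1`.
    set g : ℕ → ℝ := fun m => if m = 0 then 0 else
      if h : m - 1 < d then (x (P ⟨m - 1, h⟩) - gridPoint nG k (P ⟨m - 1, h⟩)) / gridStep nG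
      else 1 with hg
    have hg0 : g 0 = 0 := by simp [hg]
    have hgd : g (d + 1) = 1 := by simp [hg]
    have hgi : ∀ i : Fin d, g (i + 1) = (x (P i) - gridPoint nG k (P i)) / gridStep nG := by
      intro i
      simp [hg, i.2]
    have hmono : ∀ m, m ≤ d → g m ≤ g (m + 1) := by
      intro m hm
      rcases Nat.eq_zero_or_pos m with rfl | hpos
      · rw [hg0]
        rcases Nat.eq_zero_or_pos d with rfl | hd
        · rw [hgd]; norm_num
        · have := hgi ⟨0, hd⟩
          simp only at this
          rw [this]
          have := (h1 (P ⟨0, hd⟩)).1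
          apply div_nonneg _ hε.le
          linarith
      · obtain ⟨m, rfl⟩ : ∃ m', m = m' + 1 := ⟨m - 1, by omega⟩
        have e1 := hgi ⟨m, by omega⟩
        simp only at e1
        rw [e1]
        rcases Nat.lt_or_ge (m + 1) d with hlt | hge
        · have e2 := hgi ⟨m + 1, hlt⟩
          simp only at e2
          rw [e2]
          have := h2 ⟨m, by omega⟩ ⟨m + 1, hlt⟩ (by simp [Fin.le_def])
          gcongr
        · have : m + 1 = d := by omega
          rw [show m + 1 + 1 = d + 1 by omega, hgd]
          have := (h1 (P ⟨m, by omega⟩)).2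
          rw [div_le_one hε]
          linarith
    have hsum : ∀ n, ∑ m ∈ Finset.range n, (g (m + 1) - g m) = g n := by
      intro n
      rw [Finset.sum_range_sub, hg0, sub_zero]
    have key : x = ∑ j : Fin (d + 1), (g ((j : ℕ) + 1) - g j) • kuhnVertex nG k P j := by
      ext i
      have hi := hgi (P.symm i)
      rw [Equiv.apply_symm_apply] at hi
      have hx : x i = gridPoint nG k i + gridStep nG * g ((P.symm i : ℕ) + 1) := by
        rw [hi]; field_simp; ring
      have : ∀ j : Fin (d + 1), ((g ((j : ℕ) + 1) - g j) • kuhnVertex nG k P j) i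
          = (g ((j : ℕ) + 1) - g j) * gridPoint nG k i + gridStep nG *
            (if (j : ℕ) ≤ (P.symm i : ℕ) then (g ((j : ℕ) + 1) - g j) else 0) := by
        intro j
        simp only [kuhnVertex, gridPoint, PiLp.smul_apply, smul_eq_mul]
        split_ifs <;> push_cast <;> ring
      rw [hx, WithLp.ofLp_sum, Finset.sum_apply, Finset.sum_congr rfl (fun j _ => this j),
        Finset.sum_add_distrib, ← Finset.sum_mul, ← Finset.mul_sum,
        Fin.sum_univ_eq_sum_range (fun m => g (m + 1) - g m) (d + 1), hsum, hgd,
        Fin.sum_univ_eq_sum_range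
          (fun m => if m ≤ (P.symm i : ℕ) then (g (m + 1) - g m) else 0) (d + 1),
        ← Finset.sum_filter]
      have hf : (Finset.range (d + 1)).filter (fun m => m ≤ (P.symm i : ℕ))
          = Finset.range ((P.symm i : ℕ) + 1) := by
        ext m
        have := (P.symm i).2
        simp only [Finset.mem_filter, Finset.mem_range]
        omega
      rw [hf, hsum]
      ring
    rw [key]
    apply (convex_convexHull ℝ _).sum_mem
    · intro j _
      have := hmono j (by omega)
      linarith
    · rw [Fin.sum_univ_eq_sum_range (fun m => g (m + 1) - g m) (d + 1), hsum, hgd]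
    · intro j _
      apply subset_convexHull
      simp [kuhnVertices]

/-- The set `𝒦_d(G)` of the K-simplices of all the cubes of the grid, each given by its
vertices. An `i`-dimensional face of such a simplex `S` is given by `i + 1` vertices of `S`. -/
def kSimplices (d nG : ℕ) : Set (Finset (Pt d)) :=
  {S | ∃ (k : Fin d → ℕ) (P : Equiv.Perm (Fin d)),
    (∀ i, k i + 1 < nG) ∧ S = kuhnVertices nG k P}

/-- `p` is a boundary point on the edge `[v₋, v₊]` divided into `n` equal parts, `𝓜` being
the classification function: `p` is the midpoint of a part, at the start of which the label is
not `+1`, and at the end of which it is `+1`. (The label at the start is `-1` or, if that point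
happens to lie on the manifold, `0`; successive dichotomies treat `0` as `-1`.) -/
def IsBoundaryPoint {d : ℕ} (𝓜 : Pt d → SignType) (n : ℕ) (vneg vpos p : Pt d) : Prop :=
  ∃ i : ℕ, i < n ∧
    𝓜 (vneg + ((i : ℝ) / n) • (vpos - vneg)) ≠ 1 ∧
    𝓜 (vneg + (((i : ℝ) + 1) / n) • (vpos - vneg)) = 1 ∧
    p = vneg + (((i : ℝ) + 1 / 2) / n) • (vpos - vneg)

open Classical in
/-- The set `B_M(F)` of the boundary points on the edges of the face with vertices `F`, where
`b v₋ v₊` is the boundary point of the edge `[v₋, v₊]` with `𝓜 v₋ = -1` and `𝓜 v₊ = +1`. -/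
noncomputable def boundaryPoints {d : ℕ} (𝓜 : Pt d → SignType) (b : Pt d → Pt d → Pt d)
    (F : Finset (Pt d)) : Finset (Pt d) :=
  ((F ×ˢ F).filter (fun e => 𝓜 e.1 = -1 ∧ 𝓜 e.2 = 1)).image (fun e => b e.1 e.2)

/-- The barycentre of `B_M(F)`. -/
noncomputable def boundaryBarycentre {d : ℕ} (𝓜 : Pt d → SignType) (b : Pt d → Pt d → Pt d)
    (F : Finset (Pt d)) : Pt d :=
  (boundaryPoints 𝓜 b F).centroid ℝ id

/-- `F 1 ⊆ F 2 ⊆ … ⊆ F (d-1) ⊆ F d = S` are faces of `S` of dimensions `1, 2, …, d`, and there is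
a boundary point on the edge `F 1`. -/
structure IsResistarChain {d : ℕ} (𝓜 : Pt d → SignType) (b : Pt d → Pt d → Pt d)
    (S : Finset (Pt d)) (F : ℕ → Finset (Pt d)) : Prop where
  face : ∀ i, 1 ≤ i → i ≤ d → F i ⊆ S ∧ (F i).card = i + 1
  incl : ∀ i, 2 ≤ i → i ≤ d → F (i - 1) ⊆ F i
  edge : (boundaryPoints 𝓜 b (F 1)).Nonempty
  top : F d = S

/-- The K-resistar `[B_M(S)]^⋆` of the K-simplex `S`: the union of the simplices spanned by the
barycentres of `B_M(F 1), …, B_M(F (d-1)), B_M(S)`. -/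
def kResistar {d : ℕ} (𝓜 : Pt d → SignType) (b : Pt d → Pt d → Pt d) (S : Finset (Pt d)) :
    Set (Pt d) :=
  ⋃ (F : ℕ → Finset (Pt d)) (_ : IsResistarChain 𝓜 b S F),
    convexHull ℝ ((fun i => boundaryBarycentre 𝓜 b (F i)) '' Set.Icc 1 d)

/-- The K-resistar approximation on the grid: the union of the K-resistars of all the K-simplices
of the grid that have boundary points. -/
def kResistarGrid {d : ℕ} (nG : ℕ) (𝓜 : Pt d → SignType) (b : Pt d → Pt d → Pt d) :
    Set (Pt d) :=
  ⋃ (S : Finset (Pt d)) (_ : S ∈ kSimplices d nG ∧ (boundaryPoints 𝓜 b S).Nonempty),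
    kResistar 𝓜 b S

/-- The closed half-space of `ℝ^n` on which the first coordinate is nonnegative
(the one-point space `ℝ^0` if `n = 0`). -/
def halfSpace (n : ℕ) : Set (Pt n) := {y | ∀ h : 0 < n, 0 ≤ y ⟨0, h⟩}

/-- The boundary hyperplane of `halfSpace n` (empty if `n = 0`). -/
def halfSpaceBoundary (n : ℕ) : Set (Pt n) := {y | ∃ h : 0 < n, y ⟨0, h⟩ = 0}

/-- `R` is an `n`-dimensional topological manifold with boundary `R ∩ Z`: each point of `R` is in
the domain of a chart, which is a homeomorphism from an open subset of `R` to an open subset of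
the half-space, and charts map exactly the points of `Z` to the boundary of the half-space.
(Subspaces of `ℝ^d` are Hausdorff and second countable.) -/
def IsManifoldWithBoundary {d : ℕ} (n : ℕ) (R Z : Set (Pt d)) : Prop :=
  ∀ x : R, ∃ φ : OpenPartialHomeomorph R (halfSpace n), x ∈ φ.source ∧
    ∀ y ∈ φ.source, (φ y : Pt n) ∈ halfSpaceBoundary n ↔ (y : Pt d) ∈ Z

/-- The K-resistars of the K-simplices are consistently charted on hyperplanes. Each K-simplex `S`
with boundary points has an affine hyperplane `H_S` (the zeros of `ℓ S`) that strictly separates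
its vertices labelled `+1` from those labelled `-1`, and a homeomorphism `φ S` of its K-resistar
(which is compact) onto `S ∩ H_S`, which respects all faces of `S`; the K-resistars of any two
K-simplices coincide on the common points of these, and so do their charts. -/
def HasConsistentCharts {d : ℕ} (nG : ℕ) (𝓜 : Pt d → SignType) (b : Pt d → Pt d → Pt d) :
    Prop :=
  ∃ (ℓ : Finset (Pt d) → Pt d →ᵃ[ℝ] ℝ) (φ : Finset (Pt d) → Pt d → Pt d),
    (∀ S ∈ kSimplices d nG, (boundaryPoints 𝓜 b S).Nonempty →
      (∀ v ∈ S, (𝓜 v = 1 → 0 < ℓ S v) ∧ (𝓜 v = -1 → ℓ S v < 0)) ∧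
      ContinuousOn (φ S) (kResistar 𝓜 b S) ∧
      Set.InjOn (φ S) (kResistar 𝓜 b S) ∧
      ∀ F ⊆ S, φ S '' (kResistar 𝓜 b S ∩ convexHull ℝ (F : Set (Pt d))) =
        {x ∈ convexHull ℝ (F : Set (Pt d)) | ℓ S x = 0}) ∧
    (∀ S ∈ kSimplices d nG, ∀ S' ∈ kSimplices d nG,
      kResistar 𝓜 b S ∩ convexHull ℝ (S' : Set (Pt d)) =
        kResistar 𝓜 b S' ∩ convexHull ℝ (S : Set (Pt d)) ∧
      Set.EqOn (φ S) (φ S') (kResistar 𝓜 b S ∩ kResistar 𝓜 b S'))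

/-! The K-resistars form a subcomplex of a generalised barycentric subdivision of the Kuhn
triangulation, and moving the centres of that subdivision turns them into a piecewise linear zero
set.

Choose a centre in the relative interior of every face of a triangulation. Every point of the space
is then a unique convex combination of the centres of a chain of faces (`chain_weights_unique`,
`exists_chain_weights`). The compact space `chainWeights` of such weights does not depend on the
centres, so two choices of centres give a homeomorphism of the space onto itself
(`IsCentre.transfer`). It preserves every face, because the carrier of a point is read off the
support of its weights.

Take as centre of a face with both labels the barycentre of its boundary points, and of any other
face the barycentre of its vertices. All that matters about the boundary points is that they lie
strictly inside their edges (`IsEdgeChoice.isCentre`). The K-resistars then consist of the points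
whose weights are supported on mixed faces (`mem_kResistar_iff`). If the boundary points are moved
to the midpoints of the edges, these points become the zero set of the piecewise affine
interpolation of the labels (`interpolate_realize_midpoint_eq_zero_iff`). In each simplex this zero
set is a hyperplane section, and the one global homeomorphism provides all the consistent charts
(`hasConsistentCharts`).

For the manifold property it remains to study that zero set. At a zero, the carrier has a vertex `p`
labelled `+1` and a vertex `q` labelled `-1`. Small moves along `p - q` stay in the cube and change
the interpolation at constant speed (`exists_direction`). Projecting along this direction makes the
zero set locally a copy of a piece of a cube of one dimension less
(`isManifoldWithBoundary_zeroSet`), which has explicit half-space charts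
(`isManifoldWithBoundary_unitCube`). -/

/-! ### Weighted chains of finite sets -/

/-- A weighted chain of finite sets is determined by the weighted sum of nonnegative vectors whose
supports are the sets of the chain. -/
theorem chain_weights_unique {ι : Type*} (𝔉 : Finset (Finset ι)) (a : Finset ι → ι → ℝ)
    (hpos : ∀ F ∈ 𝔉, ∀ v ∈ F, 0 < a F v) (hzero : ∀ F ∈ 𝔉, ∀ v, v ∉ F → a F v = 0)
    (hne : ∀ F ∈ 𝔉, F.Nonempty) (w w' : Finset ι → ℝ)
    (hw : ∀ F, 0 ≤ w F) (hw' : ∀ F, 0 ≤ w' F)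
    (hc : ∀ F F', ¬ F ⊆ F' → ¬ F' ⊆ F → w F * w F' = 0)
    (hc' : ∀ F F', ¬ F ⊆ F' → ¬ F' ⊆ F → w' F * w' F' = 0)
    (h : ∀ F ∈ 𝔉, ∀ v ∈ F, ∑ F' ∈ 𝔉, w F' * a F' v = ∑ F' ∈ 𝔉, w' F' * a F' v) :
    ∀ F ∈ 𝔉, w F = w' F := by
  classical
  by_contra! hcon
  -- Consider a set `F` of largest cardinality on which the weights differ: all larger sets
  -- contribute equally to both sums.
  obtain ⟨F₀, hF₀, hF₀ne⟩ := hcon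
  obtain ⟨F, hF, hmax⟩ := (𝔉.filter (fun F => w F ≠ w' F)).exists_max_image Finset.card
    ⟨F₀, by simp [hF₀, hF₀ne]⟩
  simp only [Finset.mem_filter] at hF hmax
  obtain ⟨hF, hFne⟩ := hF
  clear hF₀ne hF₀ F₀
  wlog hlt : w' F < w F generalizing w w'
  · exact this w' w hw' hw hc' hc (fun F hF v hv => (h F hF v hv).symm)
      (fun G hG => hmax G ⟨hG.1, hG.2.symm⟩) hFne.symm (lt_of_le_of_ne (not_lt.1 hlt) hFne)
  have hnn : ∀ G ∈ 𝔉, ∀ v, 0 ≤ a G v := fun G hG v => by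
    by_cases hv : v ∈ G
    · exact (hpos G hG v hv).le
    · exact (hzero G hG v hv).ge
  -- Since `F` itself contributes more on the side of `w`, equality at `v` requires `w'` to charge
  -- another set through `v` that is no larger than `F`.
  have hcover : ∀ v ∈ F, ∃ G ∈ 𝔉, v ∈ G ∧ w' G ≠ 0 ∧ G.card ≤ F.card ∧ G ≠ F := by
    intro v hv
    by_contra! hno
    have h1 := h F hF v hv
    have h2 : ∑ G ∈ 𝔉, w' G * a G v < ∑ G ∈ 𝔉, w G * a G v := by
      apply Finset.sum_lt_sum
      · intro G hG
        by_cases hGF : G = F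
        · subst hGF
          exact mul_le_mul_of_nonneg_right hlt.le (hnn G hG v)
        by_cases hcard : F.card < G.card
        · have : w G = w' G := by
            by_contra hne'
            exact absurd (hmax G ⟨hG, hne'⟩) (not_le.2 hcard)
          rw [this]
        by_cases hvG : v ∈ G
        · by_cases hz : w' G = 0
          · rw [hz, zero_mul]
            exact mul_nonneg (hw G) (hnn G hG v)
          · exact absurd (hno G hG hvG hz (not_lt.1 hcard)) hGF
        · rw [hzero G hG v hvG]; simp
      · exact ⟨F, hF, mul_lt_mul_of_pos_right hlt (hpos F hF v hv)⟩
    exact absurd h1 (ne_of_gt h2)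
  obtain ⟨v₀, hv₀⟩ := hne F hF
  obtain ⟨G₀, hG₀, -, hG₀w, hG₀c, hG₀F⟩ := hcover v₀ hv₀
  -- The sets charged by `w'` form a chain, so the largest of these covering sets contains all of
  -- `F`. Being no larger than `F`, it equals `F`, which was excluded.
  obtain ⟨G, hG, hGmax⟩ := Finset.exists_max_image
    (𝔉.filter (fun G => w' G ≠ 0 ∧ G.card ≤ F.card ∧ G ≠ F)) Finset.card ⟨G₀, by simp [hG₀, hG₀w, hG₀c, hG₀F]⟩
  simp only [Finset.mem_filter] at hG hGmax
  obtain ⟨hG, hGw, hGc, hGF⟩ := hG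
  have hsub : F ⊆ G := by
    intro v hv
    obtain ⟨G', hG', hvG', hG'w, hG'c, hG'F⟩ := hcover v hv
    by_cases h1 : G' ⊆ G
    · exact h1 hvG'
    by_cases h2 : G ⊆ G'
    · rwa [Finset.eq_of_subset_of_card_le h2 (hGmax G' ⟨hG', hG'w, hG'c, hG'F⟩)]
    · exact absurd (hc' G' G h1 h2) (mul_ne_zero hG'w hGw)
  exact hGF (Finset.eq_of_subset_of_card_le hsub hGc).symm

/-- Every nonnegative vector is a weighted sum over a chain of nonempty subsets of its support of
given vectors that are positive exactly on these subsets. -/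
theorem exists_chain_weights {ι : Type*} (a : Finset ι → ι → ℝ) (F : Finset ι)
    (hpos : ∀ G ⊆ F, ∀ v ∈ G, 0 < a G v) (hzero : ∀ G ⊆ F, ∀ v, v ∉ G → a G v = 0)
    (y : ι → ℝ) (hy : ∀ v ∈ F, 0 < y v) (hy0 : ∀ v, v ∉ F → y v = 0) :
    ∃ w : Finset ι → ℝ, (∀ G, 0 ≤ w G) ∧ (∀ G, w G ≠ 0 → G ⊆ F ∧ G.Nonempty) ∧
      (∀ G G', ¬ G ⊆ G' → ¬ G' ⊆ G → w G * w G' = 0) ∧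
      ∀ v, ∑ G ∈ F.powerset, w G * a G v = y v := by
  classical
  induction hn : F.card using Nat.strong_induction_on generalizing F y with
  | _ n ih =>
    rcases F.eq_empty_or_nonempty with rfl | hF
    · refine ⟨0, by simp, by simp, by simp, fun v => ?_⟩
      simp [hy0 v (by simp)]
    -- Greedy step: `t` is the largest multiple of `a F` that can be subtracted with a nonnegative
    -- remainder. The remainder vanishes at the minimiser `u`, so its support is strictly smaller
    -- and induction applies.
    obtain ⟨u, hu, hmin⟩ := F.exists_min_image (fun v => y v / a F v) hF
    set t := y u / a F u with ht
    have hapos := hpos F subset_rfl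
    have htpos : 0 < t := div_pos (hy u hu) (hapos u hu)
    set y' : ι → ℝ := fun v => y v - t * a F v with hy'
    have hy'nn : ∀ v, 0 ≤ y' v := by
      intro v
      by_cases hv : v ∈ F
      · have := hmin v hv
        rw [le_div_iff₀ (hapos v hv)] at this
        simp only [hy']; linarith
      · simp [hy', hy0 v hv, hzero F subset_rfl v hv]
    have hy'u : y' u = 0 := by
      have := (hapos u hu).ne'
      simp only [hy', ht]; field_simp; ring
    set F' := F.filter (fun v => y' v ≠ 0) with hF'
    have hF'F : F' ⊆ F := Finset.filter_subset _ _
    have huF' : u ∉ F' := by simp [hF', hy'u]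
    have hss : F' ⊂ F := (Finset.ssubset_iff_of_subset hF'F).2 ⟨u, hu, huF'⟩
    obtain ⟨w, hw1, hw2, hw3, hw4⟩ := ih F'.card (hn ▸ Finset.card_lt_card hss) F'
      (fun G hG => hpos G (hG.trans hF'F)) (fun G hG => hzero G (hG.trans hF'F)) y'
      (fun v hv => lt_of_le_of_ne (hy'nn v) (Finset.mem_filter.1 hv).2.symm)
      (fun v hv => by
        by_cases hvF : v ∈ F
        · by_contra h0
          exact hv (Finset.mem_filter.2 ⟨hvF, h0⟩)
        · simp [hy', hy0 v hvF, hzero F subset_rfl v hvF]) rfl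
    -- The recursive weights live on subsets of `F'`, which misses `u`; setting the weight of `F` to
    -- `t` therefore overwrites a zero.
    have hwF : w F = 0 := by
      by_contra h0
      exact huF' ((hw2 F h0).1 hu)
    have hwF' : ∀ G, w G ≠ 0 → G ⊆ F := fun G hG => (hw2 G hG).1.trans hF'F
    refine ⟨fun G => if G = F then t else w G, fun G => ?_, fun G => ?_, fun G G' h1 h2 => ?_,
      fun v => ?_⟩
    · dsimp only; split_ifs
      exacts [htpos.le, hw1 G]
    · dsimp only; split_ifs with h
      · subst h; exact fun _ => ⟨subset_rfl, hF⟩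
      · exact fun h0 => ⟨hwF' G h0, (hw2 G h0).2⟩
    · dsimp only
      split_ifs with e1 e2 e2
      · subst e1 e2; exact absurd subset_rfl h1
      · subst e1
        by_contra h0
        exact h2 (hwF' G' (right_ne_zero_of_mul h0))
      · subst e2
        by_contra h0
        exact h1 (hwF' G (left_ne_zero_of_mul h0))
      · exact hw3 G G' h1 h2
    · have e : ∑ G ∈ F.powerset, (if G = F then t else w G) * a G v =
          ∑ G ∈ F.powerset, ((if G = F then t * a F v else 0) + w G * a G v) := by
        refine Finset.sum_congr rfl fun G _ => ?_
        split_ifs with h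
        · subst h; rw [hwF]; ring
        · ring
      rw [e, Finset.sum_add_distrib, Finset.sum_ite_eq' F.powerset F]
      have e2 : ∑ G ∈ F.powerset, w G * a G v = ∑ G ∈ F'.powerset, w G * a G v := by
        symm
        apply Finset.sum_subset (Finset.powerset_mono.2 hF'F)
        intro G _ hG
        by_cases h0 : w G = 0
        · simp [h0]
        · exact absurd (Finset.mem_powerset.2 (hw2 G h0).1) hG
      rw [e2, hw4]
      simp [hy']

/-! ### Triangulations through their barycentric coordinates -/

/-- A finite family of simplices in a normed space, with continuous functions on the space which
restrict to the barycentric coordinates on each simplex. -/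
structure Triangulation (E : Type*) [NormedAddCommGroup E] [NormedSpace ℝ E] where
  vertices : Finset E
  simplices : Set (Finset E)
  subset_vertices : ∀ S ∈ simplices, S ⊆ vertices
  coord : E → E → ℝ
  continuous_coord : ∀ v, Continuous (coord v)
  coord_sum : ∀ S ∈ simplices, ∀ μ : E → ℝ, (∀ v ∈ S, 0 ≤ μ v) → ∑ v ∈ S, μ v = 1 →
    (∀ v, v ∉ S → μ v = 0) → ∀ u ∈ vertices, coord u (∑ v ∈ S, μ v • v) = μ u

namespace Triangulation

variable {E : Type*} [NormedAddCommGroup E] [NormedSpace ℝ E] (T : Triangulation E)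

/-- The union of the simplices of a triangulation. -/
def space : Set E := ⋃ S ∈ T.simplices, convexHull ℝ (S : Set E)

theorem mem_space {x : E} : x ∈ T.space ↔ ∃ S ∈ T.simplices, x ∈ convexHull ℝ (S : Set E) := by
  simp [space]

/-- The field `coord_sum` speaks of all vertices of the triangulation, also those outside `S`. It
thus encodes both the uniqueness of barycentric coordinates and the fact that simplices meet along
common faces. -/
theorem exists_coord_eq {S : Finset E} (hS : S ∈ T.simplices) {x : E}
    (hx : x ∈ convexHull ℝ (S : Set E)) :
    ∃ μ : E → ℝ, (∀ v, 0 ≤ μ v) ∧ ∑ v ∈ S, μ v = 1 ∧ (∀ v, v ∉ S → μ v = 0) ∧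
      ∑ v ∈ S, μ v • v = x ∧ ∀ u ∈ T.vertices, T.coord u x = μ u := by
  classical
  obtain ⟨w, h0, h1, h2⟩ := Finset.mem_convexHull'.1 hx
  have e1 : ∑ v ∈ S, (if v ∈ S then w v else 0) = 1 := by
    rw [← h1]; exact Finset.sum_congr rfl fun v hv => by simp [hv]
  have e2 : ∑ v ∈ S, (if v ∈ S then w v else 0) • v = x := by
    rw [← h2]; exact Finset.sum_congr rfl fun v hv => by simp [hv]
  refine ⟨fun v => if v ∈ S then w v else 0, fun v => ?_, e1, fun v hv => by simp [hv], e2,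
    fun u hu => ?_⟩
  · dsimp only; split_ifs with h
    exacts [h0 v h, le_rfl]
  · conv_lhs => rw [← e2]
    exact T.coord_sum S hS (fun v => if v ∈ S then w v else 0)
      (fun v hv => by simpa [hv] using h0 v hv) e1 (fun v hv => by simp [hv]) u hu

theorem coord_nonneg {x : E} (hx : x ∈ T.space) {u : E} (hu : u ∈ T.vertices) :
    0 ≤ T.coord u x := by
  obtain ⟨S, hS, hx⟩ := T.mem_space.1 hx
  obtain ⟨μ, h0, -, -, -, h⟩ := T.exists_coord_eq hS hx
  rw [h u hu]; exact h0 u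

theorem coord_eq_zero {S : Finset E} (hS : S ∈ T.simplices) {x : E}
    (hx : x ∈ convexHull ℝ (S : Set E)) {u : E} (hu : u ∈ T.vertices) (huS : u ∉ S) :
    T.coord u x = 0 := by
  obtain ⟨μ, -, -, h0, -, h⟩ := T.exists_coord_eq hS hx
  rw [h u hu]; exact h0 u huS

theorem sum_coord_smul_simplex {S : Finset E} (hS : S ∈ T.simplices) {x : E}
    (hx : x ∈ convexHull ℝ (S : Set E)) : ∑ v ∈ S, T.coord v x • v = x := by
  obtain ⟨μ, -, -, -, h1, h⟩ := T.exists_coord_eq hS hx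
  rw [← h1]
  exact Finset.sum_congr rfl fun v hv => by rw [h1, h v (T.subset_vertices S hS hv)]

theorem sum_coord_simplex {S : Finset E} (hS : S ∈ T.simplices) {x : E}
    (hx : x ∈ convexHull ℝ (S : Set E)) : ∑ v ∈ S, T.coord v x = 1 := by
  obtain ⟨μ, -, h1, -, -, h⟩ := T.exists_coord_eq hS hx
  rw [← h1]
  exact Finset.sum_congr rfl fun v hv => h v (T.subset_vertices S hS hv)

theorem sum_coord {x : E} (hx : x ∈ T.space) : ∑ v ∈ T.vertices, T.coord v x = 1 := by
  obtain ⟨S, hS, hx⟩ := T.mem_space.1 hx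
  rw [← T.sum_coord_simplex hS hx]
  exact (Finset.sum_subset (T.subset_vertices S hS)
    fun v hv hvS => T.coord_eq_zero hS hx hv hvS).symm

theorem sum_coord_smul {x : E} (hx : x ∈ T.space) :
    ∑ v ∈ T.vertices, T.coord v x • v = x := by
  obtain ⟨S, hS, hx⟩ := T.mem_space.1 hx
  conv_rhs => rw [← T.sum_coord_smul_simplex hS hx]
  exact (Finset.sum_subset (T.subset_vertices S hS)
    fun v hv hvS => by rw [T.coord_eq_zero hS hx hv hvS, zero_smul]).symm

theorem ext_coord {x y : E} (hx : x ∈ T.space) (hy : y ∈ T.space)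
    (h : ∀ u ∈ T.vertices, T.coord u x = T.coord u y) : x = y := by
  rw [← T.sum_coord_smul hx, ← T.sum_coord_smul hy]
  exact Finset.sum_congr rfl fun v hv => by rw [h v hv]

theorem mem_convexHull_of_coord {x : E} (hx : x ∈ T.space) {F : Finset E}
    (h : ∀ u ∈ T.vertices, u ∉ F → T.coord u x = 0) : x ∈ convexHull ℝ (F : Set E) := by
  classical
  have key : ∀ f : E → E, (∑ v ∈ T.vertices, T.coord v x • f v) =
      ∑ v ∈ T.vertices.filter (· ∈ F), T.coord v x • f v := by
    intro f
    rw [Finset.sum_filter]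
    refine Finset.sum_congr rfl fun v hv => ?_
    split_ifs with hF
    · rfl
    · rw [h v hv hF, zero_smul]
  rw [← T.sum_coord_smul hx, key (fun v => v)]
  refine (convex_convexHull ℝ _).sum_mem (fun v hv => T.coord_nonneg hx (Finset.mem_filter.1 hv).1)
    ?_ (fun v hv => subset_convexHull ℝ _ (Finset.mem_filter.1 hv).2)
  rw [← T.sum_coord hx, Finset.sum_filter]
  refine Finset.sum_congr rfl fun v hv => ?_
  split_ifs with hF
  · rfl
  · rw [h v hv hF]

theorem coord_eq_zero_of_face {S F : Finset E} (hS : S ∈ T.simplices) (hF : F ⊆ S) {x : E}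
    (hx : x ∈ convexHull ℝ (F : Set E)) {u : E} (hu : u ∈ T.vertices) (huF : u ∉ F) :
    T.coord u x = 0 := by
  classical
  obtain ⟨w, h0, h1, h2⟩ := Finset.mem_convexHull'.1 hx
  have e : ∀ v, v ∈ F → v ∈ S := fun v hv => hF hv
  have e1 : ∑ v ∈ S, (if v ∈ F then w v else 0) = 1 := by
    rw [← h1, ← Finset.sum_filter, Finset.filter_mem_eq_inter, Finset.inter_eq_right.2 hF]
  have e2 : ∑ v ∈ S, (if v ∈ F then w v else 0) • v = x := by
    simp_rw [ite_smul, zero_smul]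
    rw [← h2, ← Finset.sum_filter, Finset.filter_mem_eq_inter, Finset.inter_eq_right.2 hF]
  rw [← e2, T.coord_sum S hS (fun v => if v ∈ F then w v else 0)
    (fun v _ => ?_) e1 (fun v hv => if_neg fun h => hv (hF h)) u hu, if_neg huF]
  split_ifs with h
  exacts [h0 v h, le_rfl]

/-- Coordinates are affine on one simplex only. Points with zero weight are left unrestricted, so
that sums over all faces can be used when the weights are supported on a chain. -/
theorem coord_weighted_sum {S : Finset E} (hS : S ∈ T.simplices) {ι : Type*} (t : Finset ι)
    (a : ι → ℝ) (x : ι → E) (ha : ∀ i ∈ t, 0 ≤ a i) (ha1 : ∑ i ∈ t, a i = 1)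
    (hx : ∀ i ∈ t, a i ≠ 0 → x i ∈ convexHull ℝ (S : Set E)) {u : E} (hu : u ∈ T.vertices) :
    T.coord u (∑ i ∈ t, a i • x i) = ∑ i ∈ t, a i * T.coord u (x i) := by
  classical
  have hmul : ∀ v ∈ T.vertices, ∀ i ∈ t, 0 ≤ a i * T.coord v (x i) := by
    intro v hv i hi
    by_cases h0 : a i = 0
    · simp [h0]
    · exact mul_nonneg (ha i hi) (T.coord_nonneg (T.mem_space.2 ⟨S, hS, hx i hi h0⟩) hv)
  set μ : E → ℝ := fun v => if v ∈ S then ∑ i ∈ t, a i * T.coord v (x i) else 0 with hμ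
  have e : ∑ i ∈ t, a i • x i = ∑ v ∈ S, μ v • v := by
    have e1 : ∀ v ∈ S, μ v • v = ∑ i ∈ t, a i • (T.coord v (x i) • v) := by
      intro v hv
      simp only [hμ, if_pos hv, Finset.sum_smul, mul_smul]
    rw [Finset.sum_congr rfl e1, Finset.sum_comm]
    refine Finset.sum_congr rfl fun i hi => ?_
    rw [← Finset.smul_sum]
    by_cases h0 : a i = 0
    · simp [h0]
    · rw [T.sum_coord_smul_simplex hS (hx i hi h0)]
  have e2 : ∑ v ∈ S, μ v = 1 := by
    have e1 : ∀ v ∈ S, μ v = ∑ i ∈ t, a i * T.coord v (x i) := fun v hv => by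
      simp only [hμ, if_pos hv]
    rw [Finset.sum_congr rfl e1, Finset.sum_comm, ← ha1]
    refine Finset.sum_congr rfl fun i hi => ?_
    rw [← Finset.mul_sum]
    by_cases h0 : a i = 0
    · simp [h0]
    · rw [T.sum_coord_simplex hS (hx i hi h0), mul_one]
  rw [e, T.coord_sum S hS μ (fun v hv => ?_) e2 (fun v hv => by simp [hμ, hv]) u hu]
  · by_cases huS : u ∈ S
    · simp only [hμ, if_pos huS]
    · simp only [hμ, if_neg huS]
      symm
      refine Finset.sum_eq_zero fun i hi => ?_
      by_cases h0 : a i = 0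
      · simp [h0]
      · rw [T.coord_eq_zero hS (hx i hi h0) hu huS, mul_zero]
  · simp only [hμ, if_pos hv]
    exact Finset.sum_nonneg (hmul v (T.subset_vertices S hS hv))

/-! ### Subdivisions with prescribed centres -/

open Classical in
/-- The nonempty faces of the simplices of a triangulation. -/
noncomputable def faces : Finset (Finset E) :=
  T.vertices.powerset.filter (fun F => F.Nonempty ∧ ∃ S ∈ T.simplices, F ⊆ S)

theorem mem_faces {F : Finset E} : F ∈ T.faces ↔ F.Nonempty ∧ ∃ S ∈ T.simplices, F ⊆ S := by
  simp only [faces, Finset.mem_filter, Finset.mem_powerset, and_iff_right_iff_imp]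
  rintro ⟨-, S, hS, hF⟩
  exact hF.trans (T.subset_vertices S hS)

/-- The convex weights on the faces of a triangulation that are supported on a chain. -/
def chainWeights : Set (Finset E → ℝ) :=
  {w | (∀ F, 0 ≤ w F) ∧ (∀ F, F ∉ T.faces → w F = 0) ∧ ∑ F ∈ T.faces, w F = 1 ∧
    ∀ F F', ¬ F ⊆ F' → ¬ F' ⊆ F → w F * w F' = 0}

/-- The conditions are closed and confine the weights to a product of unit intervals, which is
compact by Tychonoff although its index type may be infinite. -/
theorem isCompact_chainWeights : IsCompact T.chainWeights := by
  have hK : IsCompact (Set.univ.pi fun _ : Finset E => Set.Icc (0 : ℝ) 1) :=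
    isCompact_univ_pi fun _ => isCompact_Icc
  refine hK.of_isClosed_subset ?_ ?_
  · have e : T.chainWeights = (⋂ F, {w | 0 ≤ w F}) ∩ ((⋂ F, ⋂ (_ : F ∉ T.faces), {w | w F = 0}) ∩
        ({w | ∑ F ∈ T.faces, w F = 1} ∩
        ⋂ F, ⋂ F', ⋂ (_ : ¬ F ⊆ F'), ⋂ (_ : ¬ F' ⊆ F), {w | w F * w F' = 0})) := by
      ext w; simp [chainWeights]
    rw [e]
    refine (isClosed_iInter fun F => isClosed_le continuous_const (continuous_apply F)).inter
      ((isClosed_iInter fun F => isClosed_iInter fun _ => isClosed_eq (continuous_apply F)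
        continuous_const).inter ((isClosed_eq (by fun_prop) continuous_const).inter ?_))
    exact isClosed_iInter fun F => isClosed_iInter fun F' => isClosed_iInter fun _ =>
      isClosed_iInter fun _ => isClosed_eq (by fun_prop) continuous_const
  · intro w hw F _
    refine ⟨hw.1 F, ?_⟩
    by_cases hF : F ∈ T.faces
    · rw [← hw.2.2.1]
      exact Finset.single_le_sum (fun G _ => hw.1 G) hF
    · rw [hw.2.1 F hF]; exact zero_le_one

/-- The support is a nonempty finite chain, so its member of largest cardinality contains the
others. Hence all centres in use lie in one simplex. -/
theorem exists_top {w : Finset E → ℝ} (hw : w ∈ T.chainWeights) :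
    ∃ F ∈ T.faces, w F ≠ 0 ∧ ∀ G, w G ≠ 0 → G ⊆ F := by
  classical
  have hne : (T.faces.filter (fun F => w F ≠ 0)).Nonempty := by
    by_contra h
    rw [Finset.not_nonempty_iff_eq_empty, Finset.filter_eq_empty_iff] at h
    have := hw.2.2.1
    rw [Finset.sum_eq_zero fun F hF => not_not.1 (h hF)] at this
    exact zero_ne_one this
  obtain ⟨F, hF, hmax⟩ := Finset.exists_max_image _ Finset.card hne
  simp only [Finset.mem_filter] at hF hmax
  refine ⟨F, hF.1, hF.2, fun G hG => ?_⟩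
  have hGf : G ∈ T.faces := by
    by_contra h
    exact hG (hw.2.1 G h)
  by_contra h1
  by_cases h2 : F ⊆ G
  · exact h1 (Finset.eq_of_subset_of_card_le h2 (hmax G ⟨hGf, hG⟩)).ge
  · exact mul_ne_zero hG hF.2 (hw.2.2.2 G F h1 h2)

/-- The function `c` chooses a point in the relative interior of each face. -/
def IsCentre (c : Finset E → E) : Prop :=
  ∀ F ∈ T.faces, c F ∈ convexHull ℝ (F : Set E) ∧ ∀ v ∈ F, 0 < T.coord v (c F)

/-- The point with weights `w` in the subdivision of a triangulation with centres `c`. -/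
noncomputable def realize (c : Finset E → E) (w : Finset E → ℝ) : E :=
  ∑ F ∈ T.faces, w F • c F

variable {T} {c : Finset E → E}

theorem IsCentre.coord_eq_zero (hc : T.IsCentre c) {F : Finset E} (hF : F ∈ T.faces) {u : E}
    (hu : u ∈ T.vertices) (huF : u ∉ F) : T.coord u (c F) = 0 := by
  obtain ⟨-, S, hS, hFS⟩ := T.mem_faces.1 hF
  exact T.coord_eq_zero_of_face hS hFS (hc F hF).1 hu huF

theorem IsCentre.coord_realize (hc : T.IsCentre c) {w : Finset E → ℝ} (hw : w ∈ T.chainWeights)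
    {u : E} (hu : u ∈ T.vertices) :
    T.coord u (T.realize c w) = ∑ F ∈ T.faces, w F * T.coord u (c F) := by
  obtain ⟨F₀, hF₀, -, htop⟩ := T.exists_top hw
  obtain ⟨-, S, hS, hFS⟩ := T.mem_faces.1 hF₀
  exact T.coord_weighted_sum hS _ w c (fun F _ => hw.1 F) hw.2.2.1
    (fun F hF h0 => convexHull_mono (by exact_mod_cast (htop F h0).trans hFS) (hc F hF).1) hu

theorem IsCentre.realize_mem_convexHull (hc : T.IsCentre c) {w : Finset E → ℝ}
    (hw : w ∈ T.chainWeights) {F : Finset E} (hF : ∀ G, w G ≠ 0 → G ⊆ F) :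
    T.realize c w ∈ convexHull ℝ (F : Set E) := by
  classical
  have e : T.realize c w = ∑ G ∈ T.faces.filter (fun G => w G ≠ 0), w G • c G := by
    rw [realize, Finset.sum_filter]
    refine Finset.sum_congr rfl fun G _ => ?_
    split_ifs with h
    · rfl
    · rw [not_not.1 h, zero_smul]
  rw [e]
  refine (convex_convexHull ℝ _).sum_mem (fun G _ => hw.1 G) ?_ fun G hG => ?_
  · rw [Finset.sum_filter_ne_zero]; exact hw.2.2.1
  · rw [Finset.mem_filter] at hG
    exact convexHull_mono (by exact_mod_cast hF G hG.2) (hc G hG.1).1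

theorem IsCentre.realize_mem_space (hc : T.IsCentre c) {w : Finset E → ℝ}
    (hw : w ∈ T.chainWeights) : T.realize c w ∈ T.space := by
  obtain ⟨F₀, hF₀, -, htop⟩ := T.exists_top hw
  obtain ⟨-, S, hS, hFS⟩ := T.mem_faces.1 hF₀
  exact T.mem_space.2 ⟨S, hS, hc.realize_mem_convexHull hw fun G h => (htop G h).trans hFS⟩

/-- No cancellation can occur, because every term is nonnegative. The right-hand side does not
involve `c`, which is why a change of centres preserves faces. -/
theorem IsCentre.coord_realize_eq_zero_iff (hc : T.IsCentre c) {w : Finset E → ℝ}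
    (hw : w ∈ T.chainWeights) {u : E} (hu : u ∈ T.vertices) :
    T.coord u (T.realize c w) = 0 ↔ ∀ F, w F ≠ 0 → u ∉ F := by
  have hmem : ∀ F, w F ≠ 0 → F ∈ T.faces := fun F h => by
    by_contra h'
    exact h (hw.2.1 F h')
  have hnn : ∀ F ∈ T.faces, 0 ≤ T.coord u (c F) := fun F hF => by
    obtain ⟨-, S, hS, hFS⟩ := T.mem_faces.1 hF
    exact T.coord_nonneg
      (T.mem_space.2 ⟨S, hS, convexHull_mono (by exact_mod_cast hFS) (hc F hF).1⟩) hu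
  rw [hc.coord_realize hw hu,
    Finset.sum_eq_zero_iff_of_nonneg fun F hF => mul_nonneg (hw.1 F) (hnn F hF)]
  constructor
  · intro h F hF huF
    exact mul_ne_zero hF ((hc F (hmem F hF)).2 u huF).ne' (h F (hmem F hF))
  · intro h F hF
    by_cases h0 : w F = 0
    · rw [h0, zero_mul]
    · rw [hc.coord_eq_zero hF hu (h F h0), mul_zero]

theorem IsCentre.realize_injOn (hc : T.IsCentre c) : Set.InjOn (T.realize c) T.chainWeights := by
  classical
  intro w hw w' hw' h
  have hv : ∀ F ∈ T.faces, ∀ v ∈ F, v ∈ T.vertices := fun F hF v hv => by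
    obtain ⟨-, S, hS, hFS⟩ := T.mem_faces.1 hF
    exact T.subset_vertices S hS (hFS hv)
  have key := chain_weights_unique T.faces
    (fun F v => if v ∈ T.vertices then T.coord v (c F) else 0)
    (fun F hF v hvF => by rw [if_pos (hv F hF v hvF)]; exact (hc F hF).2 v hvF)
    (fun F hF v hvF => by
      split_ifs with h
      exacts [hc.coord_eq_zero hF h hvF, rfl])
    (fun F hF => (T.mem_faces.1 hF).1) w w' hw.1 hw'.1 hw.2.2.2 hw'.2.2.2
    (fun F hF v hvF => by
      simp only [if_pos (hv F hF v hvF)]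
      rw [← hc.coord_realize hw (hv F hF v hvF), ← hc.coord_realize hw' (hv F hF v hvF), h])
  funext F
  by_cases hF : F ∈ T.faces
  · exact key F hF
  · rw [hw.2.1 F hF, hw'.2.1 F hF]

theorem IsCentre.exists_realize_eq (hc : T.IsCentre c) {x : E} (hx : x ∈ T.space) :
    ∃ w ∈ T.chainWeights, T.realize c w = x := by
  classical
  -- `F` is to be the carrier of `x`; the greedy decomposition of the coordinate vector of `x` over
  -- subsets of `F` yields the weights.
  obtain ⟨S, hS, hxS⟩ := T.mem_space.1 hx
  set F := S.filter (fun v => T.coord v x ≠ 0) with hF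
  have hFS : F ⊆ S := Finset.filter_subset _ _
  have hSv := T.subset_vertices S hS
  have hface : ∀ G ⊆ F, G.Nonempty → G ∈ T.faces := fun G hG hne =>
    T.mem_faces.2 ⟨hne, S, hS, hG.trans hFS⟩
  have hFne : F.Nonempty := by
    by_contra h
    rw [Finset.not_nonempty_iff_eq_empty, Finset.filter_eq_empty_iff] at h
    have h1 := T.sum_coord_simplex hS hxS
    rw [Finset.sum_eq_zero fun v hv => not_not.1 (h hv)] at h1
    exact zero_ne_one h1
  obtain ⟨w, h1, h2, h3, h4⟩ := exists_chain_weights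
    (fun G v => if v ∈ G then T.coord v (c G) else 0) F
    (fun G hG v hv => by rw [if_pos hv]; exact (hc G (hface G hG ⟨v, hv⟩)).2 v hv)
    (fun G _ v hv => if_neg hv) (fun v => if v ∈ S then T.coord v x else 0)
    (fun v hv => by
      rw [if_pos (hFS hv)]
      exact lt_of_le_of_ne (T.coord_nonneg hx (hSv (hFS hv))) (Finset.mem_filter.1 hv).2.symm)
    (fun v hv => by
      split_ifs with h
      · by_contra h0
        exact hv (Finset.mem_filter.2 ⟨h, h0⟩)
      · rfl)
  have h2' : ∀ G, G ∉ T.faces → w G = 0 := fun G hG => by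
    by_contra h0
    exact hG (hface G (h2 G h0).1 (h2 G h0).2)
  have hsum : ∀ f : Finset E → ℝ, ∑ G ∈ T.faces, w G * f G = ∑ G ∈ F.powerset, w G * f G := by
    intro f
    have hz : ∀ G, w G * f G ≠ 0 → G ∈ T.faces ∧ G ∈ F.powerset := fun G h => by
      have := h2 G (left_ne_zero_of_mul h)
      exact ⟨hface G this.1 this.2, Finset.mem_powerset.2 this.1⟩
    rw [← Finset.sum_subset (Finset.inter_subset_left (s₁ := T.faces) (s₂ := F.powerset)),
      ← Finset.sum_subset (Finset.inter_subset_right (s₁ := T.faces) (s₂ := F.powerset))]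
    all_goals
      intro G _ hG
      by_contra h
      exact hG (Finset.mem_inter.2 (hz G h))
  have h4' : ∀ v ∈ T.vertices, ∑ G ∈ T.faces, w G * T.coord v (c G) = T.coord v x := by
    intro v hv
    have e : ∑ G ∈ F.powerset, w G * T.coord v (c G) =
        ∑ G ∈ F.powerset, w G * (if v ∈ G then T.coord v (c G) else 0) := by
      refine Finset.sum_congr rfl fun G hG => ?_
      split_ifs with h
      · rfl
      · by_cases h0 : w G = 0
        · simp [h0]
        · rw [hc.coord_eq_zero (hface G (h2 G h0).1 (h2 G h0).2) hv h]
    rw [hsum, e, h4 v]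
    split_ifs with h
    · rfl
    · exact (T.coord_eq_zero hS hxS hv h).symm
  -- The coordinates of each centre add up to `1`, as do those of `x`, so adding the decomposition
  -- over all vertices gives the total weight.
  have hone : ∑ G ∈ T.faces, w G = 1 := by
    rw [← T.sum_coord hx, ← Finset.sum_congr rfl h4', Finset.sum_comm]
    refine Finset.sum_congr rfl fun G hG => ?_
    obtain ⟨-, S', hS', hGS'⟩ := T.mem_faces.1 hG
    rw [← Finset.mul_sum, T.sum_coord (T.mem_space.2
      ⟨S', hS', convexHull_mono (by exact_mod_cast hGS') (hc G hG).1⟩), mul_one]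
  have hw : w ∈ T.chainWeights := ⟨h1, h2', hone, h3⟩
  refine ⟨w, hw, T.ext_coord (hc.realize_mem_space hw) hx fun u hu => ?_⟩
  rw [hc.coord_realize hw hu, h4' u hu]

/-- The subdivision with centres `c` as a homeomorphism from the space of weighted chains of faces
to the space of the triangulation. -/
noncomputable def IsCentre.homeomorph (hc : T.IsCentre c) : T.chainWeights ≃ₜ T.space :=
  haveI : CompactSpace T.chainWeights := isCompact_iff_compactSpace.1 T.isCompact_chainWeights
  Continuous.homeoOfEquivCompactToT2
    (f := Equiv.ofBijective (fun w => ⟨T.realize c w, hc.realize_mem_space w.2⟩)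
      ⟨fun w w' h => Subtype.ext (hc.realize_injOn w.2 w'.2 (congrArg Subtype.val h)), fun x => by
        obtain ⟨w, hw, h⟩ := hc.exists_realize_eq x.2
        exact ⟨⟨w, hw⟩, Subtype.ext h⟩⟩)
    (by
      refine Continuous.subtype_mk ?_ _
      exact continuous_finsetSum _ fun F _ =>
        ((continuous_apply F).comp continuous_subtype_val).smul continuous_const)

theorem IsCentre.coe_homeomorph (hc : T.IsCentre c) (w : T.chainWeights) :
    (hc.homeomorph w : E) = T.realize c w := rfl

end Triangulation

/-! ### The Kuhn triangulation of the unit cube -/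

theorem gridStep_pos {nG : ℕ} (hnG : 2 ≤ nG) : 0 < gridStep nG := by
  have : (2 : ℝ) ≤ nG := by exact_mod_cast hnG
  exact one_div_pos.2 (by linarith)

theorem gridPoint_apply {d : ℕ} (nG : ℕ) (m : Fin d → ℕ) (i : Fin d) :
    gridPoint nG m i = (m i : ℝ) * gridStep nG := rfl

theorem kuhnVertex_apply {d : ℕ} (nG : ℕ) (k : Fin d → ℕ) (P : Equiv.Perm (Fin d))
    (j : Fin (d + 1)) (i : Fin d) :
    kuhnVertex nG k P j i =
      gridPoint nG k i + gridStep nG * (if (j : ℕ) ≤ (P.symm i : ℕ) then 1 else 0) := by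
  simp only [kuhnVertex, gridPoint_apply]
  split_ifs <;> push_cast <;> ring

theorem kuhnVertex_injective {d nG : ℕ} (hnG : 2 ≤ nG) (k : Fin d → ℕ)
    (P : Equiv.Perm (Fin d)) : Function.Injective (kuhnVertex nG k P) := by
  intro j j' h
  wlog hlt : j < j' generalizing j j'
  · rcases lt_trichotomy j j' with h1 | h1 | h1
    exacts [this h h1, h1, (this h.symm h1).symm]
  have hj : (j : ℕ) < d := by have := j'.2; have : (j : ℕ) < j' := hlt; omega
  have h1 : kuhnVertex nG k P j (P ⟨j, hj⟩) = kuhnVertex nG k P j' (P ⟨j, hj⟩) := by rw [h]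
  have h2 : ¬ (j' : ℕ) ≤ j := not_le.2 hlt
  have := gridStep_pos hnG
  simp only [kuhnVertex_apply, Equiv.symm_apply_apply, le_refl, if_true, if_neg h2] at h1
  linarith

/-- Coordinate `i` is raised exactly at the vertices with index at most `P.symm i`, so the relative
coordinates of a point, in the order `P`, are the partial sums of its barycentric coordinates. -/
theorem sum_kuhnVertex_apply {d : ℕ} (nG : ℕ) (k : Fin d → ℕ) (P : Equiv.Perm (Fin d))
    (μ : ℕ → ℝ) (hμ : ∑ m ∈ Finset.range (d + 1), μ m = 1) (i : Fin d) :
    (∑ j : Fin (d + 1), μ j • kuhnVertex nG k P j) i =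
      gridPoint nG k i + gridStep nG * ∑ m ∈ Finset.range ((P.symm i : ℕ) + 1), μ m := by
  have : ∀ j : Fin (d + 1), (μ j • kuhnVertex nG k P j) i = μ j * gridPoint nG k i +
      gridStep nG * (if (j : ℕ) ≤ (P.symm i : ℕ) then μ j else 0) := by
    intro j
    rw [PiLp.smul_apply, kuhnVertex_apply]
    split_ifs <;> simp only [smul_eq_mul] <;> ring
  rw [WithLp.ofLp_sum, Finset.sum_apply, Finset.sum_congr rfl (fun j _ => this j),
    Finset.sum_add_distrib, ← Finset.sum_mul, ← Finset.mul_sum, Fin.sum_univ_eq_sum_range μ, hμ,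
    Fin.sum_univ_eq_sum_range (fun m => if m ≤ (P.symm i : ℕ) then μ m else 0) (d + 1),
    ← Finset.sum_filter, one_mul]
  congr 3
  ext m
  have := (P.symm i).2
  simp only [Finset.mem_filter, Finset.mem_range]
  omega

/-- The tent function centred at the vertex `v` of the Kuhn triangulation of mesh `gridStep nG`. -/
noncomputable def kuhnCoord {d : ℕ} (nG : ℕ) (v x : Pt d) : ℝ :=
  max 0 (1 - ‖fun i => max 0 ((x i - v i) / gridStep nG)‖ -
    ‖fun i => max 0 ((v i - x i) / gridStep nG)‖)

theorem continuous_kuhnCoord {d : ℕ} (nG : ℕ) (v : Pt d) : Continuous (kuhnCoord nG v) := by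
  unfold kuhnCoord
  fun_prop

section Coord

variable {d nG : ℕ} {k : Fin d → ℕ} {P : Equiv.Perm (Fin d)} {μ : ℕ → ℝ}

theorem partialSum_mono (h0 : ∀ m, 0 ≤ μ m) {a b : ℕ} (hab : a ≤ b) :
    ∑ m ∈ Finset.range a, μ m ≤ ∑ m ∈ Finset.range b, μ m :=
  Finset.sum_le_sum_of_subset_of_nonneg (Finset.range_mono hab) fun m _ _ => h0 m

/-- With `s` the partial sums, the two sup norms in the tent function are `s j` and `1 - s (j + 1)`,
so the tent has height `s (j + 1) - s j = μ j`. -/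
theorem kuhnCoord_kuhnVertex (hnG : 2 ≤ nG) (h0 : ∀ m, 0 ≤ μ m)
    (hμ : ∑ m ∈ Finset.range (d + 1), μ m = 1) (j : Fin (d + 1)) :
    kuhnCoord nG (kuhnVertex nG k P j) (∑ j : Fin (d + 1), μ j • kuhnVertex nG k P j) = μ j := by
  have hε := gridStep_pos hnG
  set x := ∑ j : Fin (d + 1), μ j • kuhnVertex nG k P j with hx
  set s : ℕ → ℝ := fun n => ∑ m ∈ Finset.range n, μ m with hs
  have hmono : ∀ {a b : ℕ}, a ≤ b → s a ≤ s b := fun h => partialSum_mono h0 h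
  have hs0 : ∀ n, 0 ≤ s n := fun n => Finset.sum_nonneg fun m _ => h0 m
  have hs1 : s (d + 1) = 1 := hμ
  have hu : ∀ i, (x i - kuhnVertex nG k P j i) / gridStep nG =
      s ((P.symm i : ℕ) + 1) - (if (j : ℕ) ≤ (P.symm i : ℕ) then 1 else 0) := by
    intro i
    rw [hx, sum_kuhnVertex_apply nG k P μ hμ, kuhnVertex_apply]
    field_simp
    ring
  have hu' : ∀ i, (kuhnVertex nG k P j i - x i) / gridStep nG =
      (if (j : ℕ) ≤ (P.symm i : ℕ) then 1 else 0) - s ((P.symm i : ℕ) + 1) := by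
    intro i
    rw [← neg_sub (x i), neg_div, hu, neg_sub]
  have e1 : ‖fun i => max 0 ((x i - kuhnVertex nG k P j i) / gridStep nG)‖ = s j := by
    apply le_antisymm
    · refine (pi_norm_le_iff_of_nonneg (hs0 _)).2 fun i => ?_
      rw [Real.norm_of_nonneg (le_max_left _ _), hu]
      refine max_le (hs0 _) ?_
      split_ifs with h
      · have := hmono (show (P.symm i : ℕ) + 1 ≤ d + 1 by omega)
        have := hs0 j
        linarith
      · rw [sub_zero]; exact hmono (by omega)
    -- The maximum is attained at the last coordinate that is low at the vertex, of rank `j - 1`;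
    -- for `j = 0` there is none and the value is `0`.
    · rcases Nat.eq_zero_or_pos (j : ℕ) with hj | hj
      · rw [hj]; simp [hs]
      · have hlt : (j : ℕ) - 1 < d := by have := j.2; omega
        refine le_trans ?_ (norm_le_pi_norm _ (P ⟨j - 1, hlt⟩))
        refine le_trans ?_ (le_abs_self _)
        refine le_trans ?_ (le_max_right _ _)
        rw [hu, Equiv.symm_apply_apply]
        simp only
        rw [if_neg (by omega), sub_zero, Nat.sub_add_cancel hj]
  have e2 : ‖fun i => max 0 ((kuhnVertex nG k P j i - x i) / gridStep nG)‖ = 1 - s (j + 1) := by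
    have hle : s (j + 1) ≤ 1 := hs1 ▸ hmono (by have := j.2; omega)
    apply le_antisymm
    · refine (pi_norm_le_iff_of_nonneg (by linarith)).2 fun i => ?_
      rw [Real.norm_of_nonneg (le_max_left _ _), hu']
      refine max_le (by linarith) ?_
      split_ifs with h
      · have := hmono (show (j : ℕ) + 1 ≤ (P.symm i : ℕ) + 1 by omega)
        linarith
      · have := hs0 ((P.symm i : ℕ) + 1)
        linarith
    -- The maximum is attained at the first raised coordinate, of rank `j`; for `j = d` there is
    -- none and `s (d + 1) = 1`.
    · rcases (Nat.lt_succ_iff.1 j.2).eq_or_lt with hj | hj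
      · rw [hj, hs1, sub_self]; exact norm_nonneg _
      · refine le_trans ?_ (norm_le_pi_norm _ (P ⟨j, hj⟩))
        refine le_trans ?_ (le_abs_self _)
        refine le_trans ?_ (le_max_right _ _)
        rw [hu', Equiv.symm_apply_apply]
        simp
  have e3 : s (j + 1) = s j + μ j := Finset.sum_range_succ _ _
  rw [kuhnCoord, e1, e2, e3]
  rw [max_eq_right] <;> linarith [h0 j]

/-- A positive tent value would force `m - k` to take the values `0` and `1` only and to be
nondecreasing along `P`, and such a grid point is a vertex of the simplex. -/
theorem kuhnCoord_eq_zero (hnG : 2 ≤ nG) (h0 : ∀ m, 0 ≤ μ m)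
    (hμ : ∑ m ∈ Finset.range (d + 1), μ m = 1) (m : Fin d → ℕ)
    (hm : ∀ j, gridPoint nG m ≠ kuhnVertex nG k P j) :
    kuhnCoord nG (gridPoint nG m) (∑ j : Fin (d + 1), μ j • kuhnVertex nG k P j) = 0 := by
  have hε := gridStep_pos hnG
  set x := ∑ j : Fin (d + 1), μ j • kuhnVertex nG k P j with hx
  set s : ℕ → ℝ := fun n => ∑ m ∈ Finset.range n, μ m with hs
  have hmono : ∀ {a b : ℕ}, a ≤ b → s a ≤ s b := fun h => partialSum_mono h0 h
  have hs0 : ∀ n, 0 ≤ s n := fun n => Finset.sum_nonneg fun m _ => h0 m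
  have hs1 : s (d + 1) = 1 := hμ
  have hu : ∀ r, (x (P r) - gridPoint nG m (P r)) / gridStep nG =
      s ((r : ℕ) + 1) + k (P r) - m (P r) := by
    intro r
    rw [hx, sum_kuhnVertex_apply nG k P μ hμ, gridPoint_apply, gridPoint_apply,
      Equiv.symm_apply_apply]
    field_simp
    ring
  set A := ‖fun i => max 0 ((x i - gridPoint nG m i) / gridStep nG)‖ with hA
  set B := ‖fun i => max 0 ((gridPoint nG m i - x i) / gridStep nG)‖ with hB
  have hA1 : ∀ r : Fin d, s ((r : ℕ) + 1) + k (P r) - m (P r) ≤ A := fun r => by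
    rw [← hu]
    exact (le_max_right _ _).trans ((le_abs_self _).trans
      (norm_le_pi_norm (fun i => max 0 ((x i - gridPoint nG m i) / gridStep nG)) (P r)))
  have hB1 : ∀ r : Fin d, m (P r) - (s ((r : ℕ) + 1) + k (P r)) ≤ B := fun r => by
    have e : (gridPoint nG m (P r) - x (P r)) / gridStep nG =
        m (P r) - (s ((r : ℕ) + 1) + k (P r)) := by
      rw [← neg_sub (x (P r)), neg_div, hu]; ring
    rw [← e]
    exact (le_max_right _ _).trans ((le_abs_self _).trans
      (norm_le_pi_norm (fun i => max 0 ((gridPoint nG m i - x i) / gridStep nG)) (P r)))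
  have hA0 : 0 ≤ A := norm_nonneg _
  have hB0 : 0 ≤ B := norm_nonneg _
  rw [kuhnCoord]
  apply max_eq_left
  by_contra! hlt
  replace hlt : 0 < 1 - A - B := hlt
  have hrange : ∀ r : Fin d, m (P r) = k (P r) ∨ m (P r) = k (P r) + 1 := by
    intro r
    have h1 := hA1 r
    have h2 := hB1 r
    have h3 := hs0 ((r : ℕ) + 1)
    have h4 := hmono (show (r : ℕ) + 1 ≤ d + 1 by omega)
    rw [hs1] at h4
    have h5 : (k (P r) : ℝ) < m (P r) + 1 := by linarith
    have h6 : (m (P r) : ℝ) < k (P r) + 2 := by linarith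
    have h5' : k (P r) < m (P r) + 1 := by exact_mod_cast h5
    have h6' : m (P r) < k (P r) + 2 := by exact_mod_cast h6
    omega
  -- A raised coordinate of rank `r` followed by a low one of rank `r'` would give `A ≥ s (r' + 1)`
  -- and `B ≥ 1 - s (r + 1)`, hence `A + B ≥ 1`.
  have hord : ∀ r r' : Fin d, r ≤ r' → m (P r) = k (P r) + 1 → m (P r') = k (P r') + 1 := by
    intro r r' hr h
    by_contra h'
    have h2 := (hrange r').resolve_right h'
    have h3 := hA1 r'
    have h4 := hB1 r
    have h5 := hmono (show (r : ℕ) + 1 ≤ (r' : ℕ) + 1 by simpa using hr)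
    rw [h2] at h3
    rw [h] at h4
    push_cast at h4
    linarith
  -- The index of the vertex is the rank of the first raised coordinate, or `d` if none is raised.
  have hex : ∃ j, j = d ∨ ∃ h : j < d, m (P ⟨j, h⟩) = k (P ⟨j, h⟩) + 1 := ⟨d, Or.inl rfl⟩
  classical
  have hjd : Nat.find hex ≤ d := Nat.find_min' hex (Or.inl rfl)
  refine hm ⟨Nat.find hex, Nat.lt_succ_of_le hjd⟩ ?_
  unfold kuhnVertex
  congr 1
  funext i
  obtain ⟨r, rfl⟩ := P.surjective i
  rw [Equiv.symm_apply_apply]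
  split_ifs with h
  · simp only at h
    rcases Nat.find_spec hex with h1 | ⟨h1, h2⟩
    · have := r.2; omega
    · exact hord _ _ h h2
  · simp only [not_le] at h
    have := Nat.find_min hex h
    push Not at this
    exact (hrange r).resolve_right (this.2 r.2)

end Coord

theorem sum_kuhnVertices {d nG : ℕ} (hnG : 2 ≤ nG) (k : Fin d → ℕ) (P : Equiv.Perm (Fin d))
    {M : Type*} [AddCommMonoid M] (f : Pt d → M) :
    ∑ v ∈ kuhnVertices nG k P, f v = ∑ j, f (kuhnVertex nG k P j) := by
  classical
  unfold kuhnVertices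
  exact Finset.sum_image fun a _ b _ h => kuhnVertex_injective hnG k P h

open Classical in
/-- The Kuhn triangulation of the unit cube. -/
noncomputable def kuhnTriangulation (d nG : ℕ) (hnG : 2 ≤ nG) : Triangulation (Pt d) where
  vertices := Finset.univ.image fun m : Fin d → Fin nG => gridPoint nG fun i => m i
  simplices := kSimplices d nG
  subset_vertices := by
    rintro S ⟨k, P, hk, rfl⟩ v hv
    simp only [kuhnVertices, Finset.mem_image, Finset.mem_univ, true_and] at hv ⊢
    obtain ⟨j, rfl⟩ := hv
    exact ⟨fun i => ⟨k i + if (j : ℕ) ≤ (P.symm i : ℕ) then 1 else 0, by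
      have := hk i; split_ifs <;> omega⟩, rfl⟩
  coord := kuhnCoord nG
  continuous_coord := continuous_kuhnCoord nG
  coord_sum := by
    rintro S ⟨k, P, hk, rfl⟩ μ h0 h1 h2 u hu
    simp only [Finset.mem_image, Finset.mem_univ, true_and] at hu
    obtain ⟨m, rfl⟩ := hu
    set ν : ℕ → ℝ := fun n => if h : n < d + 1 then μ (kuhnVertex nG k P ⟨n, h⟩) else 0 with hν
    have hνj : ∀ j : Fin (d + 1), ν j = μ (kuhnVertex nG k P j) := fun j => dif_pos j.2
    have hmem : ∀ j, kuhnVertex nG k P j ∈ kuhnVertices nG k P := fun j => by simp [kuhnVertices]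
    have hν0 : ∀ n, 0 ≤ ν n := fun n => by
      simp only [hν]
      split_ifs
      exacts [h0 _ (hmem _), le_rfl]
    rw [sum_kuhnVertices hnG] at h1 ⊢
    simp_rw [← hνj] at h1 ⊢
    rw [Fin.sum_univ_eq_sum_range ν] at h1
    by_cases hm : ∃ j, gridPoint nG (fun i => (m i : ℕ)) = kuhnVertex nG k P j
    · obtain ⟨j, hj⟩ := hm
      rw [hj, kuhnCoord_kuhnVertex hnG hν0 h1, hνj]
    · push Not at hm
      rw [kuhnCoord_eq_zero hnG hν0 h1 _ hm, h2]
      simp only [kuhnVertices, Finset.mem_image, Finset.mem_univ, true_and, not_exists]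
      exact fun j h => hm j h.symm

theorem exists_gridPoint_of_mem_vertices {d nG : ℕ} {hnG : 2 ≤ nG} {v : Pt d}
    (hv : v ∈ (kuhnTriangulation d nG hnG).vertices) :
    ∃ m : Fin d → ℕ, (∀ i, m i < nG) ∧ v = gridPoint nG m := by
  simp only [kuhnTriangulation, Finset.mem_image, Finset.mem_univ, true_and] at hv
  obtain ⟨m, rfl⟩ := hv
  exact ⟨fun i => m i, fun i => (m i).2, rfl⟩

theorem gridStep_mul_le_one {nG m : ℕ} (hnG : 2 ≤ nG) (hm : m < nG) :
    (m : ℝ) * gridStep nG ≤ 1 := by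
  have h2 : (2 : ℝ) ≤ nG := by exact_mod_cast hnG
  have h3 : (m : ℝ) + 1 ≤ nG := by exact_mod_cast hm
  rw [gridStep, mul_one_div, div_le_one (by linarith)]
  linarith

theorem mem_unitCube_of_mem_vertices {d nG : ℕ} {hnG : 2 ≤ nG} {v : Pt d}
    (hv : v ∈ (kuhnTriangulation d nG hnG).vertices) : v ∈ unitCube d := by
  obtain ⟨m, hm, rfl⟩ := exists_gridPoint_of_mem_vertices hv
  exact fun i => ⟨mul_nonneg (Nat.cast_nonneg _) (gridStep_pos hnG).le,
    gridStep_mul_le_one hnG (hm i)⟩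

theorem convex_unitCube (d : ℕ) : Convex ℝ (unitCube d) := by
  intro x hx y hy a b ha hb hab i
  have := hx i
  have := hy i
  simp only [PiLp.add_apply, PiLp.smul_apply, smul_eq_mul]
  constructor
  · nlinarith
  · nlinarith

theorem kuhnTriangulation_space {d nG : ℕ} (hnG : 2 ≤ nG) :
    (kuhnTriangulation d nG hnG).space = unitCube d := by
  have hε := gridStep_pos hnG
  ext x
  rw [Triangulation.mem_space]
  constructor
  · rintro ⟨S, hS, hx⟩
    refine convexHull_min (fun v hv => ?_) (convex_unitCube d) hx
    exact mem_unitCube_of_mem_vertices ((kuhnTriangulation d nG hnG).subset_vertices S hS hv)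
  · intro hx
    -- The minimum with `nG - 2` puts points with a coordinate equal to `1` into the last cube.
    -- Sorting the relative coordinates then selects the permutation.
    set k : Fin d → ℕ := fun i => min ⌊x i / gridStep nG⌋₊ (nG - 2) with hk
    set y : Fin d → ℝ := fun i => x i - gridPoint nG k i with hy
    refine ⟨kuhnVertices nG k (Tuple.sort y), ⟨k, Tuple.sort y, fun i => ?_, rfl⟩, ?_⟩
    · simp only [hk]; omega
    rw [convexHull_kuhnVertices nG hnG]
    refine ⟨fun i => ?_, fun i j hij => Tuple.monotone_sort y hij⟩
    have h1 : 0 ≤ x i / gridStep nG := div_nonneg (hx i).1 hε.le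
    rw [gridPoint_apply]
    constructor
    · have h2 : (k i : ℝ) ≤ x i / gridStep nG :=
        le_trans (by exact_mod_cast min_le_left _ _) (Nat.floor_le h1)
      rwa [le_div_iff₀ hε] at h2
    · rcases le_total ⌊x i / gridStep nG⌋₊ (nG - 2) with h | h
      · have h2 := (Nat.lt_floor_add_one (x i / gridStep nG)).le
        rw [div_le_iff₀ hε] at h2
        simp only [hk, min_eq_left h]
        linarith
      · simp only [hk, min_eq_right h]
        have e : ((nG - 2 : ℕ) : ℝ) * gridStep nG + gridStep nG = 1 := by
          have h2 : (2 : ℝ) ≤ nG := by exact_mod_cast hnG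
          have h3 : (nG : ℝ) - 1 ≠ 0 := by linarith
          rw [Nat.cast_sub hnG, gridStep]
          push_cast
          field_simp
          ring
        rw [e]
        exact (hx i).2

theorem sum_range_ite_sub (f : ℕ → ℝ) (j n : ℕ) (hj : j ≤ n) :
    ∑ r ∈ Finset.range n, (if j ≤ r then f r - f (r + 1) else 0) = f j - f n := by
  induction n, hj using Nat.le_induction with
  | base =>
    rw [sub_self]
    exact Finset.sum_eq_zero fun r hr => if_neg (not_le.2 (Finset.mem_range.1 hr))
  | succ n hn ih => rw [Finset.sum_range_succ, ih, if_pos hn]; ring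

/-- Any labels on the vertices of a K-simplex are interpolated by an affine function. -/
theorem exists_affineMap_eq_on_kSimplex {d nG : ℕ} (hnG : 2 ≤ nG) {S : Finset (Pt d)}
    (hS : S ∈ kSimplices d nG) (L : Pt d → ℝ) : ∃ ℓ : Pt d →ᵃ[ℝ] ℝ, ∀ v ∈ S, ℓ v = L v := by
  obtain ⟨k, P, -, rfl⟩ := hS
  have hε := gridStep_pos hnG
  set f : ℕ → ℝ := fun n => if h : n < d + 1 then L (kuhnVertex nG k P ⟨n, h⟩) else 0 with hf
  -- The vertices of indices `r` and `r + 1` differ only in coordinate `P r`, by one mesh, so the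
  -- slope in this coordinate is a difference quotient of consecutive labels.
  set g : Pt d →ₗ[ℝ] ℝ := ∑ r : Fin d, ((f r - f (r + 1)) / gridStep nG) •
    (EuclideanSpace.proj (𝕜 := ℝ) (P r) : Pt d →L[ℝ] ℝ).toLinearMap with hg
  have hgx : ∀ x, g x = ∑ r : Fin d, ((f r - f (r + 1)) / gridStep nG) * x (P r) := by
    intro x
    simp [hg]
  refine ⟨g.toAffineMap + AffineMap.const ℝ _ (f d - g (gridPoint nG k)), fun v hv => ?_⟩
  simp only [kuhnVertices, Finset.mem_image, Finset.mem_univ, true_and] at hv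
  obtain ⟨j, rfl⟩ := hv
  have e : g (kuhnVertex nG k P j) - g (gridPoint nG k) = f j - f d := by
    rw [hgx, hgx, ← Finset.sum_sub_distrib, ← sum_range_ite_sub f j d (Nat.lt_succ_iff.1 j.2),
      ← Fin.sum_univ_eq_sum_range (fun r => if (j : ℕ) ≤ r then f r - f (r + 1) else 0)]
    refine Finset.sum_congr rfl fun r _ => ?_
    rw [kuhnVertex_apply, Equiv.symm_apply_apply]
    split_ifs
    · field_simp; ring
    · ring
  have ej : f j = L (kuhnVertex nG k P j) := dif_pos j.2
  simp only [AffineMap.coe_add, Pi.add_apply, LinearMap.coe_toAffineMap, AffineMap.const_apply]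
  rw [← ej]
  linarith

/-! ### Half-space charts of the cube -/

/-- Two continuous maps which are inverse to each other between relatively open subsets of two
sets define a chart. -/
theorem exists_openPartialHomeomorph {E E' : Type*} [TopologicalSpace E] [TopologicalSpace E']
    {R : Set E} {H : Set E'} {f : E → E'} {g : E' → E} (hf : Continuous f) (hg : Continuous g)
    (x : R) {U : Set E} {W : Set E'} (hU : IsOpen U) (hW : IsOpen W) (hxU : (x : E) ∈ U)
    (hxW : f x ∈ W) (h1 : ∀ y ∈ R, y ∈ U → f y ∈ H ∧ g (f y) = y)
    (h2 : ∀ z ∈ H, z ∈ W → g z ∈ R ∧ f (g z) = z) :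
    ∃ φ : OpenPartialHomeomorph R H, x ∈ φ.source ∧
      ∀ y ∈ φ.source, (y : E) ∈ U ∧ (φ y : E') = f y := by
  classical
  -- The values outside `U` and `W` are arbitrary fillers; source and target exclude the places
  -- where they could matter.
  set F : R → H := fun y => if h : f y ∈ H then ⟨f y, h⟩ else ⟨f x, (h1 x x.2 hxU).1⟩ with hF
  set G : H → R := fun z => if h : g z ∈ R then ⟨g z, h⟩ else x with hG
  have hFy : ∀ y : R, (y : E) ∈ U → (F y : E') = f y := fun y hy => by
    simp only [hF, dif_pos (h1 y y.2 hy).1]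
  have hGz : ∀ z : H, (z : E') ∈ W → (G z : E) = g z := fun z hz => by
    simp only [hG, dif_pos (h2 z z.2 hz).1]
  refine ⟨{ toFun := F
            invFun := G
            source := {y | (y : E) ∈ U ∧ f y ∈ W}
            target := {z | (z : E') ∈ W ∧ g z ∈ U}
            map_source' := ?_
            map_target' := ?_
            left_inv' := ?_
            right_inv' := ?_
            open_source := ?_
            open_target := ?_
            continuousOn_toFun := ?_
            continuousOn_invFun := ?_ }, ⟨hxU, hxW⟩, fun y hy => ⟨hy.1, hFy y hy.1⟩⟩
  · rintro y ⟨hyU, hyW⟩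
    simp only [Set.mem_ofPred_eq]
    rw [hFy y hyU, (h1 y y.2 hyU).2]
    exact ⟨hyW, hyU⟩
  · rintro z ⟨hzW, hzU⟩
    simp only [Set.mem_ofPred_eq]
    rw [hGz z hzW, (h2 z z.2 hzW).2]
    exact ⟨hzU, hzW⟩
  · rintro y ⟨hyU, hyW⟩
    apply Subtype.ext
    rw [hGz _ (by rw [hFy y hyU]; exact hyW), hFy y hyU, (h1 y y.2 hyU).2]
  · rintro z ⟨hzW, hzU⟩
    apply Subtype.ext
    rw [hFy _ (by rw [hGz z hzW]; exact hzU), hGz z hzW, (h2 z z.2 hzW).2]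
  · rw [Topology.IsInducing.subtypeVal.continuousOn_iff]
    exact (hf.comp continuous_subtype_val).continuousOn.congr fun y hy => hFy y hy.1
  · rw [Topology.IsInducing.subtypeVal.continuousOn_iff]
    exact (hg.comp continuous_subtype_val).continuousOn.congr fun z hz => hGz z hz.1
  · exact (hU.preimage continuous_subtype_val).inter
      (hW.preimage (hf.comp continuous_subtype_val))
  · exact (hW.preimage continuous_subtype_val).inter
      (hU.preimage (hg.comp continuous_subtype_val))

theorem isOpen_setOf_coord_mem_Ioo {n : ℕ} (i : Fin n) :
    IsOpen {x : Pt n | 0 < x i ∧ x i < 1} :=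
  isOpen_Ioo.preimage (show Continuous fun x : Pt n => x i by fun_prop)

theorem isOpen_interior_unitCube (n : ℕ) : IsOpen {x : Pt n | ∀ i, 0 < x i ∧ x i < 1} := by
  rw [Set.ofPred_forall]
  exact isOpen_iInter_of_finite isOpen_setOf_coord_mem_Ioo

theorem frontier_unitCube (n : ℕ) :
    frontier (unitCube n) = {x | x ∈ unitCube n ∧ ∃ i, x i = 0 ∨ x i = 1} := by
  have e : unitCube n = (PiLp.homeomorph 2 (fun _ : Fin n => ℝ)) ⁻¹'
      (Set.univ.pi fun _ => Set.Icc 0 1) := by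
    ext x
    exact ⟨fun h i _ => h i, fun h i => h i trivial⟩
  have hc : IsClosed (unitCube n) := by
    rw [e]
    exact (isClosed_set_pi fun _ _ => isClosed_Icc).preimage (Homeomorph.continuous _)
  have hi : interior (unitCube n) = {x | ∀ i, 0 < x i ∧ x i < 1} := by
    rw [e, ← Homeomorph.preimage_interior, interior_pi_set Set.finite_univ]
    ext x
    simp only [interior_Icc]
    exact ⟨fun h i => h i trivial, fun h i _ => h i⟩
  rw [hc.frontier_eq, hi]
  ext x
  simp only [Set.mem_sdiff, Set.mem_ofPred_eq, and_congr_right_iff]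
  intro hx
  constructor
  · intro h
    push Not at h
    obtain ⟨i, hi⟩ := h
    refine ⟨i, ?_⟩
    by_contra! hne
    exact absurd (hi (lt_of_le_of_ne (hx i).1 hne.1.symm)) (not_le.2 (lt_of_le_of_ne (hx i).2 hne.2))
  · rintro ⟨i, hi⟩ h
    have := h i
    rcases hi with hi | hi <;> rw [hi] at this <;> linarith

theorem inf'_const_add {ι : Type*} (I : Finset ι) (hI : I.Nonempty) (c : ℝ) (f : ι → ℝ) :
    I.inf' hI (fun i => c + f i) = c + I.inf' hI f := by
  apply le_antisymm
  · obtain ⟨i, hi, h⟩ := I.exists_mem_eq_inf' hI f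
    rw [h]
    exact Finset.inf'_le (fun i => c + f i) hi
  · refine Finset.le_inf' hI _ fun i hi => ?_
    linarith [Finset.inf'_le f hi]

theorem exists_chart_unitCube_of_mem_interior {n : ℕ} (x : unitCube n)
    (hx : ∀ i, 0 < (x : Pt n) i ∧ (x : Pt n) i < 1) :
    ∃ φ : OpenPartialHomeomorph (unitCube n) (halfSpace n), x ∈ φ.source ∧
      ∀ y ∈ φ.source, (φ y : Pt n) ∈ halfSpaceBoundary n ↔ (y : Pt n) ∈ frontier (unitCube n) := by
  obtain ⟨φ, hxφ, hφ⟩ := exists_openPartialHomeomorph (R := unitCube n) (H := halfSpace n)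
    continuous_id continuous_id x (isOpen_interior_unitCube n) (isOpen_interior_unitCube n) hx hx
    (fun y _ hy => ⟨fun h => (hy ⟨0, h⟩).1.le, rfl⟩)
    (fun z _ hz => ⟨fun i => ⟨(hz i).1.le, (hz i).2.le⟩, rfl⟩)
  refine ⟨φ, hxφ, fun y hy => ?_⟩
  obtain ⟨hyU, hφy⟩ := hφ y hy
  rw [hφy, frontier_unitCube]
  constructor
  · rintro ⟨h, h0⟩
    exact absurd h0 (hyU ⟨0, h⟩).1.ne'
  · rintro ⟨-, i, hi | hi⟩
    · exact absurd hi (hyU i).1.ne'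
    · exact absurd hi (hyU i).2.ne

/-- Near `x` the cube is an orthant in the inward distances to the facets through `x`. The minimum
of these distances together with their differences from one of them are global coordinates, in which
the orthant is the half-space where the minimum is nonnegative. This treats corners of every
codimension at once. -/
theorem exists_chart_unitCube_of_mem_boundary {m : ℕ} (x : unitCube (m + 1)) (i₀ : Fin (m + 1))
    (hi₀ : (x : Pt (m + 1)) i₀ = 0 ∨ (x : Pt (m + 1)) i₀ = 1) :
    ∃ φ : OpenPartialHomeomorph (unitCube (m + 1)) (halfSpace (m + 1)), x ∈ φ.source ∧
      ∀ y ∈ φ.source, (φ y : Pt (m + 1)) ∈ halfSpaceBoundary (m + 1) ↔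
        (y : Pt (m + 1)) ∈ frontier (unitCube (m + 1)) := by
  classical
  obtain ⟨x, hx⟩ := x
  simp only at hi₀
  set I : Finset (Fin (m + 1)) := Finset.univ.filter (fun i => x i = 0 ∨ x i = 1) with hI
  have hi₀I : i₀ ∈ I := by simp [hI, hi₀]
  have hIne : I.Nonempty := ⟨i₀, hi₀I⟩
  set flip : Fin (m + 1) → ℝ → ℝ := fun i t => if x i = 1 then 1 - t else t with hflip
  have hflip2 : ∀ i t, flip i (flip i t) = t := fun i t => by
    simp only [hflip]; split_ifs <;> ring
  have hflipc : ∀ i, Continuous (flip i) := fun i => by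
    simp only [hflip]; split_ifs <;> fun_prop
  have hflip01 : ∀ i t, (0 ≤ flip i t ∧ flip i t ≤ 1) ↔ (0 ≤ t ∧ t ≤ 1) := fun i t => by
    simp only [hflip]; split_ifs <;> constructor <;> rintro ⟨h1, h2⟩ <;> constructor <;> linarith
  -- The swap moves the minimum, computed in position `i₀`, to the first coordinate, where the
  -- half-space requires it.
  set σ : Equiv.Perm (Fin (m + 1)) := Equiv.swap 0 i₀ with hσ
  have hσσ : ∀ i, σ (σ i) = i := fun i => Equiv.swap_apply_self _ _ _
  have hσ0 : σ 0 = i₀ := Equiv.swap_apply_left _ _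
  have hσi₀ : σ i₀ = 0 := Equiv.swap_apply_right _ _
  set inward : Pt (m + 1) → Fin (m + 1) → ℝ := fun y i => flip i (y i) with hinward
  set f₀ : Pt (m + 1) → Fin (m + 1) → ℝ := fun y i =>
    if i = i₀ then I.inf' hIne (inward y) else
      if i ∈ I then inward y i - inward y i₀ else y i with hf₀
  set f : Pt (m + 1) → Pt (m + 1) := fun y => WithLp.toLp 2 fun i => f₀ y (σ i) with hf
  -- The differences `δ`, normalised to be `0` at `i₀`, determine the inward distances up to a
  -- common constant; `w` fixes it so that their minimum becomes `z 0`.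
  set δ : Pt (m + 1) → Fin (m + 1) → ℝ := fun z i => if i = i₀ then 0 else z (σ i) with hδ
  set w : Pt (m + 1) → Fin (m + 1) → ℝ := fun z i => z 0 + δ z i - I.inf' hIne (δ z) with hw
  set g : Pt (m + 1) → Pt (m + 1) := fun z => WithLp.toLp 2 fun i =>
    if i ∈ I then flip i (w z i) else z (σ i) with hg
  have hinwc : ∀ i, Continuous fun y => inward y i := fun i => (hflipc i).comp (by fun_prop)
  have hfc : Continuous f := by
    refine (PiLp.continuous_toLp 2 _).comp (continuous_pi fun i => ?_)
    simp only [hf₀]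
    split_ifs
    · exact Continuous.finset_inf'_apply hIne fun i _ => hinwc i
    · exact (hinwc _).sub (hinwc _)
    · fun_prop
  have hδc : ∀ i, Continuous fun z => δ z i := fun i => by
    simp only [hδ]; split_ifs <;> fun_prop
  have hgc : Continuous g := by
    refine (PiLp.continuous_toLp 2 _).comp (continuous_pi fun i => ?_)
    split_ifs
    · refine (hflipc _).comp ?_
      exact ((show Continuous fun z : Pt (m + 1) => z 0 by fun_prop).add (hδc i)).sub
        (Continuous.finset_inf'_apply hIne fun i _ => hδc i)
    · fun_prop
  set U : Set (Pt (m + 1)) := {y | (∀ i, i ∉ I → 0 < y i ∧ y i < 1) ∧ ∀ i ∈ I, inward y i < 1}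
    with hU
  have hUo : IsOpen U := by
    have e : U = (⋂ i, ⋂ (_ : i ∉ I), {y | 0 < y i ∧ y i < 1}) ∩
        ⋂ i, ⋂ (_ : i ∈ I), {y | inward y i < 1} := by
      ext y; simp [hU]
    rw [e]
    exact (isOpen_iInter_of_finite fun i => isOpen_iInter_of_finite fun _ =>
      isOpen_setOf_coord_mem_Ioo i).inter
      (isOpen_iInter_of_finite fun i => isOpen_iInter_of_finite fun _ =>
        isOpen_lt (hinwc i) continuous_const)
  have hxU : x ∈ U := by
    refine ⟨fun i hi => ?_, fun i hi => ?_⟩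
    · simp only [hI, Finset.mem_filter, Finset.mem_univ, true_and, not_or] at hi
      exact ⟨lt_of_le_of_ne (hx i).1 (Ne.symm hi.1), lt_of_le_of_ne (hx i).2 hi.2⟩
    · simp only [hI, Finset.mem_filter, Finset.mem_univ, true_and] at hi
      simp only [hinward, hflip]
      rcases hi with h | h <;> rw [h] <;> norm_num
  have hgf : ∀ y, g (f y) = y := by
    intro y
    have e1 : ∀ i, f y (σ i) = f₀ y i := fun i => by simp only [hf, hσσ]
    have e0 : f y 0 = I.inf' hIne (inward y) := by
      rw [← hσi₀, e1]; simp [hf₀]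
    have e2 : ∀ i ∈ I, δ (f y) i = -inward y i₀ + inward y i := by
      intro i hi
      simp only [hδ, e1, hf₀]
      split_ifs with h
      · rw [h]; ring
      · ring
    have e3 : I.inf' hIne (δ (f y)) = -inward y i₀ + I.inf' hIne (inward y) := by
      rw [← inf'_const_add]
      exact Finset.inf'_congr hIne rfl e2
    ext i
    simp only [hg]
    split_ifs with hi
    · simp only [hw, e0, e2 i hi, e3]
      rw [← hflip2 i (y i)]
      congr 1
      simp only [hinward]
      ring
    · rw [e1]
      have : i ≠ i₀ := fun h => hi (h ▸ hi₀I)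
      simp [hf₀, this, hi]
  have hfg : ∀ z, f (g z) = z := by
    intro z
    have e1 : ∀ i ∈ I, inward (g z) i = (z 0 - I.inf' hIne (δ z)) + δ z i := by
      intro i hi
      simp only [hinward, hg, if_pos hi, hflip2, hw]
      ring
    have e2 : I.inf' hIne (inward (g z)) = z 0 := by
      rw [Finset.inf'_congr hIne rfl e1, inf'_const_add]
      ring
    ext i
    obtain ⟨i, rfl⟩ : ∃ i', i = σ i' := ⟨σ i, (hσσ i).symm⟩
    simp only [hf, hσσ, hf₀]
    split_ifs with h1 h2
    · rw [e2, h1, hσi₀]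
    · rw [e1 i h2, e1 i₀ hi₀I]
      simp [hδ, h1]
    · simp [hg, h2]
  have hUcube : ∀ y ∈ U, y ∈ unitCube (m + 1) ↔ ∀ i ∈ I, 0 ≤ inward y i := by
    intro y hy
    constructor
    · intro h i _
      exact ((hflip01 i (y i)).2 (h i)).1
    · intro h i
      by_cases hi : i ∈ I
      · exact (hflip01 i (y i)).1 ⟨h i hi, (hy.2 i hi).le⟩
      · exact ⟨(hy.1 i hi).1.le, (hy.1 i hi).2.le⟩
  have hf0 : ∀ y, f y 0 = I.inf' hIne (inward y) := fun y => by
    simp [hf, hσ0, hf₀]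
  obtain ⟨φ, hxφ, hφ⟩ := exists_openPartialHomeomorph (R := unitCube (m + 1))
    (H := halfSpace (m + 1)) hfc hgc ⟨x, hx⟩ hUo (hUo.preimage hgc) hxU
    (by rw [Set.mem_preimage, hgf]; exact hxU)
    (fun y hy hyU => ⟨fun _ => by
      change 0 ≤ f y 0
      rw [hf0]
      exact Finset.le_inf' hIne _ ((hUcube y hyU).1 hy), hgf y⟩)
    (fun z hz hzU => ⟨(hUcube _ hzU).2 fun i hi => by
      have h0 : (0 : ℝ) ≤ z 0 := hz (Nat.succ_pos m)
      rw [← hfg z, hf0] at h0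
      exact h0.trans (Finset.inf'_le _ hi), hfg z⟩)
  refine ⟨φ, hxφ, fun y hy => ?_⟩
  obtain ⟨hyU, hφy⟩ := hφ y hy
  have hb : f y ∈ halfSpaceBoundary (m + 1) ↔ f y 0 = 0 :=
    ⟨fun ⟨_, h⟩ => h, fun h => ⟨Nat.succ_pos m, h⟩⟩
  rw [hφy, hb, hf0, frontier_unitCube]
  constructor
  · intro h
    obtain ⟨i, hi, hi'⟩ := I.exists_mem_eq_inf' hIne (inward y)
    rw [hi'] at h
    refine ⟨y.2, i, ?_⟩
    simp only [hinward, hflip] at h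
    split_ifs at h
    · exact Or.inr (by linarith)
    · exact Or.inl h
  · rintro ⟨-, i, hi⟩
    have hiI : i ∈ I := by
      by_contra hiI
      have := hyU.1 i hiI
      rcases hi with hi | hi <;> rw [hi] at this <;> linarith
    have hge := (hUcube y hyU).1 y.2
    apply le_antisymm
    · refine (Finset.inf'_le _ hiI).trans ?_
      -- In `U` inward distances are below `1`, so a coordinate in `I` equal to `0` or `1` lies on
      -- the facet through `x`, not on the opposite one.
      have h1 := hyU.2 i hiI
      simp only [hinward, hflip] at h1 ⊢
      split_ifs at h1 ⊢ <;> rcases hi with hi | hi <;> linarith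
    · exact Finset.le_inf' hIne _ hge

theorem isManifoldWithBoundary_unitCube (n : ℕ) :
    IsManifoldWithBoundary n (unitCube n) (frontier (unitCube n)) := by
  intro x
  by_cases hx : ∀ i, 0 < (x : Pt n) i ∧ (x : Pt n) i < 1
  · exact exists_chart_unitCube_of_mem_interior x hx
  · push Not at hx
    obtain ⟨i, hi⟩ := hx
    cases n with
    | zero => exact i.elim0
    | succ m =>
      refine exists_chart_unitCube_of_mem_boundary x i ?_
      rcases (x.2 i).1.eq_or_lt with h | h
      · exact Or.inl h.symm
      · exact Or.inr (le_antisymm (x.2 i).2 (hi h))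

/-! ### Zero sets with an invariant transverse direction -/

/-- The part in the unit cube of the zero set of a continuous function is a manifold with boundary
if near each of its points the function grows at unit speed along some direction in which the
cube is locally invariant. -/
theorem isManifoldWithBoundary_zeroSet {n : ℕ} {ℓ : Pt (n + 1) → ℝ} (hℓ : Continuous ℓ)
    (h : ∀ x ∈ unitCube (n + 1), ℓ x = 0 → ∃ (a : Pt (n + 1)) (U : Set (Pt (n + 1))) (δ : ℝ),
      IsOpen U ∧ x ∈ U ∧ 0 < δ ∧ ∀ y ∈ unitCube (n + 1), y ∈ U → ∀ s : ℝ, |s| < δ →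
        y + s • a ∈ unitCube (n + 1) ∧ ℓ (y + s • a) = ℓ y + s) :
    IsManifoldWithBoundary n {x | x ∈ unitCube (n + 1) ∧ ℓ x = 0}
      (frontier (unitCube (n + 1))) := by
  rintro ⟨x, hx, hx0⟩
  obtain ⟨a, U, δ, hU, hxU, hδ, hUa⟩ := h x hx hx0
  have ha : ∃ j, a j ≠ 0 := by
    by_contra! h0
    have ha0 : a = 0 := by ext i; exact h0 i
    have := (hUa x hx hxU (δ / 2) (by rw [abs_of_pos] <;> linarith)).2
    rw [ha0, smul_zero, add_zero] at this
    linarith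
  obtain ⟨j, hj⟩ := ha
  -- From a facet the cube can be entered in only one sense, whereas both `a` and `-a` are allowed
  -- directions: so `a` is tangent to every facet through `y`.
  have hface : ∀ y ∈ unitCube (n + 1), y ∈ U → ∀ i, (y i = 0 ∨ y i = 1) → a i = 0 := by
    intro y hy hyU i hi
    have h1 := (hUa y hy hyU (δ / 2) (by rw [abs_of_pos] <;> linarith)).1 i
    have h2 := (hUa y hy hyU (-(δ / 2)) (by rw [abs_neg, abs_of_pos] <;> linarith)).1 i
    simp only [PiLp.add_apply, PiLp.smul_apply, smul_eq_mul] at h1 h2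
    have h3 : δ / 2 * a i = 0 := by
      rcases hi with hi | hi <;> rw [hi] at h1 h2 <;> apply le_antisymm <;> linarith
    exact (mul_eq_zero.1 h3).resolve_left (by linarith)
  -- `π` projects along `a` onto the hyperplane through `x` that fixes coordinate `j`, and `f` then
  -- forgets this coordinate. Conversely `g` slides a point of that hyperplane along `a` until `ℓ`
  -- vanishes, which unit speed makes explicit.
  set r : Pt (n + 1) → ℝ := fun y => (y j - x j) / a j with hr
  set π : Pt (n + 1) → Pt (n + 1) := fun y => y - r y • a with hπ
  set f : Pt (n + 1) → Pt n := fun y => WithLp.toLp 2 fun i => π y (j.succAbove i) with hf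
  set ins : Pt n → Pt (n + 1) := fun z => WithLp.toLp 2 (j.insertNth (x j) (WithLp.ofLp z))
    with hins
  set g : Pt n → Pt (n + 1) := fun z => ins z - ℓ (ins z) • a with hg
  have hrc : Continuous r := by fun_prop
  have hπc : Continuous π := by fun_prop
  have hfc : Continuous f := by fun_prop
  have hinsc : Continuous ins := by
    refine (PiLp.continuous_toLp 2 _).comp ?_
    exact Continuous.finInsertNth j continuous_const (PiLp.continuous_ofLp 2 _)
  have hgc : Continuous g := hinsc.sub ((hℓ.comp hinsc).smul continuous_const)
  have hπj : ∀ y, π y j = x j := fun y => by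
    simp only [hπ, hr, PiLp.sub_apply, PiLp.smul_apply, smul_eq_mul, div_mul_cancel₀ _ hj]
    ring
  have hinsf : ∀ y, ins (f y) = π y := by
    intro y
    ext i
    rcases Fin.eq_self_or_eq_succAbove j i with rfl | ⟨i, rfl⟩
    · simp [hins, hπj]
    · simp [hins, hf]
  have hfins : ∀ (z : Pt n) (t : ℝ), f (ins z + t • a) = z := by
    intro z t
    have e : r (ins z + t • a) = t := by
      simp [hr, hins, hj]
    ext i
    simp only [hf, hπ, e, add_sub_cancel_right]
    simp [hins]
  have hinscube : ∀ z, ins z ∈ unitCube (n + 1) ↔ z ∈ unitCube n := by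
    intro z
    constructor
    · intro hz i
      simpa [hins] using hz (j.succAbove i)
    · intro hz i
      rcases Fin.eq_self_or_eq_succAbove j i with rfl | ⟨i, rfl⟩
      · simpa [hins] using hx _
      · simpa [hins] using hz i
  set V : Set (Pt (n + 1)) := U ∩ {y | |r y| < δ} ∩ π ⁻¹' U with hV
  have hVo : IsOpen V := (hU.inter (isOpen_lt hrc.abs continuous_const)).inter (hU.preimage hπc)
  have hrx : r x = 0 := by simp [hr]
  have hπx : π x = x := by simp [hπ, hrx]
  have hπV : ∀ y ∈ unitCube (n + 1), y ∈ V → π y ∈ unitCube (n + 1) ∧ ℓ (π y) = ℓ y - r y := by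
    intro y hy hyV
    have := hUa y hy hyV.1.1 (-r y) (by rw [abs_neg]; exact hyV.1.2)
    rw [neg_smul, ← sub_eq_add_neg, ← sub_eq_add_neg] at this
    exact this
  have hinsfx : ins (f x) = x := by rw [hinsf, hπx]
  obtain ⟨φ, hxφ, hφ⟩ := exists_openPartialHomeomorph
    (R := {x | x ∈ unitCube (n + 1) ∧ ℓ x = 0}) (H := unitCube n) hfc hgc ⟨x, hx, hx0⟩ hVo
    (W := ins ⁻¹' U ∩ {z | |ℓ (ins z)| < δ})
    ((hU.preimage hinsc).inter (isOpen_lt (hℓ.comp hinsc).abs continuous_const))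
    ⟨⟨hxU, by simpa [hrx] using hδ⟩, by rw [Set.mem_preimage, hπx]; exact hxU⟩
    ⟨by rw [Set.mem_preimage, hinsfx]; exact hxU, by
      rw [Set.mem_ofPred_eq, hinsfx, hx0, abs_zero]; exact hδ⟩
    (fun y hy hyV => by
      have h1 := hπV y hy.1 hyV
      refine ⟨(hinscube _).1 (by rw [hinsf]; exact h1.1), ?_⟩
      simp only [hg]
      rw [hinsf, h1.2, hy.2]
      simp [hπ])
    (fun z hz hzW => by
      have h1 := hUa (ins z) ((hinscube z).2 hz) hzW.1 (-ℓ (ins z)) (by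
        rw [abs_neg]; exact hzW.2)
      have e : g z = ins z + -ℓ (ins z) • a := by simp only [hg, neg_smul, sub_eq_add_neg]
      rw [e]
      exact ⟨⟨h1.1, by rw [h1.2]; ring⟩, hfins _ _⟩)
  -- Sliding along `a` fixes the coordinates that are at `0` or `1`, and `j` is never one of them
  -- since `a j ≠ 0`.
  have hfront : ∀ y ∈ φ.source, (φ y : Pt n) ∈ frontier (unitCube n) ↔
      (y : Pt (n + 1)) ∈ frontier (unitCube (n + 1)) := by
    intro y hy
    obtain ⟨hyV, hφy⟩ := hφ y hy
    have hπy := (hπV y y.2.1 hyV).1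
    rw [frontier_unitCube, frontier_unitCube]
    have hsucc : ∀ i : Fin n, a (j.succAbove i) = 0 → (φ y : Pt n) i = (y : Pt _) (j.succAbove i) :=
      fun i hi => by
        rw [hφy]
        simp [hf, hπ, hi]
    constructor
    · rintro ⟨-, i, hi⟩
      refine ⟨y.2.1, j.succAbove i, ?_⟩
      rwa [← hsucc i]
      refine hface _ hπy hyV.2 _ ?_
      rwa [hφy] at hi
    · rintro ⟨-, i, hi⟩
      have hai := hface y y.2.1 hyV.1.1 i hi
      rcases Fin.eq_self_or_eq_succAbove j i with rfl | ⟨i, rfl⟩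
      · exact absurd hai hj
      · exact ⟨(φ y).2, i, by rwa [hsucc i hai]⟩
  obtain ⟨ψ, hxψ, hψ⟩ := isManifoldWithBoundary_unitCube n (φ ⟨x, hx, hx0⟩)
  refine ⟨φ.trans ψ, by simp [hxφ, hxψ], fun y hy => ?_⟩
  rw [OpenPartialHomeomorph.trans_source] at hy
  exact (hψ (φ y) hy.2).trans (hfront y hy.1)

/-- A homeomorphism respecting the prospective boundaries transports the property of being a
manifold with boundary. -/
theorem IsManifoldWithBoundary.of_homeomorph {d n : ℕ} {R R' Z : Set (Pt d)}
    (h : IsManifoldWithBoundary n R' Z) (e : R ≃ₜ R')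
    (he : ∀ x : R, (e x : Pt d) ∈ Z ↔ (x : Pt d) ∈ Z) : IsManifoldWithBoundary n R Z := by
  intro x
  obtain ⟨φ, hx, hφ⟩ := h (e x)
  refine ⟨e.transOpenPartialHomeomorph φ, hx, fun y hy => ?_⟩
  exact (hφ (e y) hy).trans (he y)

/-! ### Piecewise affine interpolation of labels -/

theorem sum_inv_card {E : Type*} {s : Finset E} (hs : s.Nonempty) : ∑ _p ∈ s, (s.card : ℝ)⁻¹ = 1 := by
  rw [Finset.sum_const, nsmul_eq_mul, mul_inv_cancel₀]
  exact_mod_cast hs.card_ne_zero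

namespace Triangulation

variable {E : Type*} [NormedAddCommGroup E] [NormedSpace ℝ E] (T : Triangulation E)

theorem coord_self {S : Finset E} (hS : S ∈ T.simplices) {v : E} (hv : v ∈ S) :
    T.coord v v = 1 := by
  have h := T.sum_coord_simplex hS (subset_convexHull ℝ (S : Set E) hv)
  rwa [Finset.sum_eq_single v (fun u hu huv => T.coord_eq_zero_of_face hS
    (Finset.singleton_subset_iff.2 hv) (by simp) (T.subset_vertices S hS hu) (by simpa using huv))
    (fun h => absurd hv h)] at h

theorem coord_combo {S : Finset E} (hS : S ∈ T.simplices) {x y : E}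
    (hx : x ∈ convexHull ℝ (S : Set E)) (hy : y ∈ convexHull ℝ (S : Set E)) {a b : ℝ}
    (ha : 0 ≤ a) (hb : 0 ≤ b) (hab : a + b = 1) {u : E} (hu : u ∈ T.vertices) :
    T.coord u (a • x + b • y) = a * T.coord u x + b * T.coord u y := by
  have := T.coord_weighted_sum hS Finset.univ ![a, b] ![x, y]
    (fun i _ => by fin_cases i <;> simpa) (by simpa using hab)
    (fun i _ _ => by fin_cases i <;> simpa) hu
  simpa using this

theorem centroid_eq_sum {s : Finset E} (hs : s.Nonempty) :
    s.centroid ℝ id = ∑ p ∈ s, (s.card : ℝ)⁻¹ • p := by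
  rw [Finset.centroid_def, Finset.affineCombination_eq_linear_combination _ _ _
    (s.sum_centroidWeights_eq_one_of_nonempty ℝ hs)]
  simp

theorem centroid_mem {s : Finset E} (hs : s.Nonempty) {A : Set E} (hA : Convex ℝ A)
    (h : ∀ p ∈ s, p ∈ A) : s.centroid ℝ id ∈ A := by
  rw [centroid_eq_sum hs]
  exact hA.sum_mem (fun _ _ => by positivity) (sum_inv_card hs) h

theorem coord_centroid_pos {S : Finset E} (hS : S ∈ T.simplices) {s : Finset E}
    (h : ∀ p ∈ s, p ∈ convexHull ℝ (S : Set E)) {u : E} (hu : u ∈ T.vertices) {p : E} (hp : p ∈ s)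
    (hup : 0 < T.coord u p) : 0 < T.coord u (s.centroid ℝ id) := by
  have hs : s.Nonempty := ⟨p, hp⟩
  have hcard : (0 : ℝ) < (s.card : ℝ)⁻¹ := inv_pos.2 (by exact_mod_cast hs.card_pos)
  rw [centroid_eq_sum hs, T.coord_weighted_sum hS s _ _ (fun _ _ => hcard.le) (sum_inv_card hs)
    (fun p hp _ => h p hp) hu]
  exact Finset.sum_pos' (fun q hq => mul_nonneg hcard.le
    (T.coord_nonneg (T.mem_space.2 ⟨S, hS, h q hq⟩) hu)) ⟨p, hp, mul_pos hcard hup⟩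

/-- The piecewise affine function with the values `L` at the vertices of a triangulation. -/
noncomputable def interpolate (L : E → ℝ) (x : E) : ℝ := ∑ v ∈ T.vertices, L v * T.coord v x

theorem continuous_interpolate (L : E → ℝ) : Continuous (T.interpolate L) :=
  continuous_finsetSum _ fun v _ => continuous_const.mul (T.continuous_coord v)

theorem interpolate_weighted_sum (L : E → ℝ) {S : Finset E} (hS : S ∈ T.simplices) {ι : Type*}
    (t : Finset ι) (a : ι → ℝ) (x : ι → E) (ha : ∀ i ∈ t, 0 ≤ a i) (ha1 : ∑ i ∈ t, a i = 1)
    (hx : ∀ i ∈ t, a i ≠ 0 → x i ∈ convexHull ℝ (S : Set E)) :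
    T.interpolate L (∑ i ∈ t, a i • x i) = ∑ i ∈ t, a i * T.interpolate L (x i) := by
  unfold interpolate
  rw [Finset.sum_congr rfl fun v hv => by rw [T.coord_weighted_sum hS t a x ha ha1 hx hv]]
  simp_rw [Finset.mul_sum]
  rw [Finset.sum_comm]
  exact Finset.sum_congr rfl fun i _ => Finset.sum_congr rfl fun v _ => by ring

theorem interpolate_vertex (L : E → ℝ) {S : Finset E} (hS : S ∈ T.simplices) {v : E}
    (hv : v ∈ S) : T.interpolate L v = L v := by
  unfold interpolate
  rw [Finset.sum_eq_single v, T.coord_self hS hv, mul_one]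
  · intro u hu huv
    rw [T.coord_eq_zero_of_face hS (Finset.singleton_subset_iff.2 hv) (by simp) hu
      (by simpa using huv), mul_zero]
  · exact fun h => absurd (T.subset_vertices S hS hv) h

theorem interpolate_combo (L : E → ℝ) {S : Finset E} (hS : S ∈ T.simplices) {x y : E}
    (hx : x ∈ convexHull ℝ (S : Set E)) (hy : y ∈ convexHull ℝ (S : Set E)) {a b : ℝ}
    (ha : 0 ≤ a) (hb : 0 ≤ b) (hab : a + b = 1) :
    T.interpolate L (a • x + b • y) = a * T.interpolate L x + b * T.interpolate L y := by
  have := T.interpolate_weighted_sum L hS Finset.univ ![a, b] ![x, y]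
    (fun i _ => by fin_cases i <;> simpa) (by simpa using hab)
    (fun i _ _ => by fin_cases i <;> simpa)
  simpa using this

theorem interpolate_eq_const (L : E → ℝ) {x : E} (hx : x ∈ T.space) {l : ℝ}
    (h : ∀ v ∈ T.vertices, T.coord v x ≠ 0 → L v = l) : T.interpolate L x = l := by
  rw [interpolate, ← mul_one l, ← T.sum_coord hx, Finset.mul_sum]
  refine Finset.sum_congr rfl fun v hv => ?_
  by_cases h0 : T.coord v x = 0
  · rw [h0, mul_zero, mul_zero]
  · rw [h v hv h0]

theorem interpolate_centroid (L : E → ℝ) {S : Finset E} (hS : S ∈ T.simplices) {s : Finset E}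
    (hs : s.Nonempty) (h : ∀ p ∈ s, p ∈ convexHull ℝ (S : Set E)) {l : ℝ}
    (hl : ∀ p ∈ s, T.interpolate L p = l) : T.interpolate L (s.centroid ℝ id) = l := by
  rw [centroid_eq_sum hs, T.interpolate_weighted_sum L hS s _ _ (fun _ _ => by positivity)
    (sum_inv_card hs) (fun p hp _ => h p hp), Finset.sum_congr rfl fun p hp => by rw [hl p hp],
    ← Finset.sum_mul, sum_inv_card hs, one_mul]

/-- Both sides are affine on the simplex and agree at its vertices. This makes the zero set of the
interpolation in a simplex a hyperplane section. -/
theorem affineMap_eq_interpolate (L : E → ℝ) {S : Finset E} (hS : S ∈ T.simplices)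
    (ℓ : E →ᵃ[ℝ] ℝ) (hℓ : ∀ v ∈ S, ℓ v = L v) {x : E} (hx : x ∈ convexHull ℝ (S : Set E)) :
    ℓ x = T.interpolate L x := by
  obtain ⟨w, h0, h1, rfl⟩ := Finset.mem_convexHull'.1 hx
  have e₀ := T.interpolate_weighted_sum L hS S w id h0 h1 fun v hv _ => subset_convexHull ℝ _ hv
  simp only [id] at e₀
  rw [e₀, ℓ.decomp]
  have e : ∀ v ∈ S, w v * T.interpolate L v = w v * ℓ.linear v + w v * ℓ 0 := by
    intro v hv
    rw [T.interpolate_vertex L hS hv, ← hℓ v hv]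
    conv_lhs => rw [ℓ.decomp]
    simp [mul_add]
  rw [Finset.sum_congr rfl e, Finset.sum_add_distrib, ← Finset.sum_mul, h1]
  simp

/-- Moving a point parallel to an edge of its carrier changes only two of its coordinates. -/
theorem shift_mem {L : E → ℝ} {y p q : E} (hy : y ∈ T.space) (hp : p ∈ T.vertices)
    (hq : q ∈ T.vertices) (hpq : p ≠ q) {s : ℝ} (hps : |s| < T.coord p y)
    (hqs : |s| < T.coord q y) :
    y + s • (p - q) ∈ T.space ∧
      T.interpolate L (y + s • (p - q)) = T.interpolate L y + s * (L p - L q) := by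
  classical
  obtain ⟨S, hS, hyS⟩ := T.mem_space.1 hy
  -- Large coordinates at `p` and `q` put the edge from `p` to `q` into whichever simplex contains
  -- `y`, so one direction serves all simplices around the point.
  have hmem : ∀ u ∈ T.vertices, |s| < T.coord u y → u ∈ S := fun u hu h => by
    by_contra h'
    rw [T.coord_eq_zero hS hyS hu h'] at h
    exact absurd h (not_lt.2 (abs_nonneg s))
  have hpS := hmem p hp hps
  have hqS := hmem q hq hqs
  set μ : E → ℝ := fun v => if v ∈ S then
    T.coord v y + ((if v = p then s else 0) - if v = q then s else 0) else 0 with hμ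
  have hμS : ∀ v ∈ S, μ v = T.coord v y + ((if v = p then s else 0) - if v = q then s else 0) :=
    fun v hv => if_pos hv
  have h0 : ∀ v ∈ S, 0 ≤ μ v := by
    intro v hv
    rw [hμS v hv]
    have := abs_lt.1 hps
    have := abs_lt.1 hqs
    have := T.coord_nonneg hy (T.subset_vertices S hS hv)
    split_ifs with h1 h2 h2
    · exact absurd (h1.symm.trans h2) hpq
    · subst h1; linarith
    · subst h2; linarith
    · linarith
  have h1 : ∑ v ∈ S, μ v = 1 := by
    rw [Finset.sum_congr rfl hμS, Finset.sum_add_distrib, Finset.sum_sub_distrib,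
      Finset.sum_ite_eq' S p, Finset.sum_ite_eq' S q, if_pos hpS, if_pos hqS, sub_self, add_zero,
      T.sum_coord_simplex hS hyS]
  have h2 : ∑ v ∈ S, μ v • v = y + s • (p - q) := by
    rw [Finset.sum_congr rfl fun v hv => by rw [hμS v hv]]
    simp_rw [add_smul, sub_smul, ite_smul, zero_smul]
    rw [Finset.sum_add_distrib, Finset.sum_sub_distrib, Finset.sum_ite_eq' S p,
      Finset.sum_ite_eq' S q, if_pos hpS, if_pos hqS, T.sum_coord_smul_simplex hS hyS, smul_sub]
  have h3 : ∀ u ∈ T.vertices, T.coord u (y + s • (p - q)) =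
      T.coord u y + ((if u = p then s else 0) - if u = q then s else 0) := by
    intro u hu
    rw [← h2, T.coord_sum S hS μ h0 h1 (fun v hv => if_neg hv) u hu]
    by_cases huS : u ∈ S
    · exact hμS u huS
    · have e1 : u ≠ p := fun h => huS (h ▸ hpS)
      have e2 : u ≠ q := fun h => huS (h ▸ hqS)
      simp [hμ, huS, e1, e2, T.coord_eq_zero hS hyS hu huS]
  refine ⟨T.mem_space.2 ⟨S, hS, Finset.mem_convexHull'.2 ⟨μ, h0, h1, h2⟩⟩, ?_⟩
  unfold interpolate
  rw [Finset.sum_congr rfl fun v hv => by rw [h3 v hv]]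
  simp_rw [mul_add, mul_sub, mul_ite, mul_zero]
  rw [Finset.sum_add_distrib, Finset.sum_sub_distrib, Finset.sum_ite_eq' T.vertices p,
    Finset.sum_ite_eq' T.vertices q, if_pos hp, if_pos hq]
  ring

/-- Near a zero of the interpolation of labels `±1`, the interpolation grows at unit speed along
some direction in which the triangulated space is locally invariant. -/
theorem exists_direction {L : E → ℝ} (hL : ∀ v ∈ T.vertices, L v = 1 ∨ L v = -1) {x : E}
    (hx : x ∈ T.space) (hx0 : T.interpolate L x = 0) :
    ∃ (a : E) (U : Set E) (δ : ℝ), IsOpen U ∧ x ∈ U ∧ 0 < δ ∧ ∀ y ∈ T.space, y ∈ U → ∀ s : ℝ,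
      |s| < δ → y + s • a ∈ T.space ∧ T.interpolate L (y + s • a) = T.interpolate L y + s := by
  -- If one label were absent from the carrier of `x`, the interpolation at `x` would equal the
  -- other label instead of `0`.
  have hex : ∀ l : ℝ, (l = 1 ∨ l = -1) → ∃ p ∈ T.vertices, T.coord p x ≠ 0 ∧ L p = l := by
    intro l hl
    by_contra! h
    have : T.interpolate L x = -l := T.interpolate_eq_const L hx fun v hv h0 => by
      have h1 := h v hv h0
      rcases hl with rfl | rfl <;> rcases hL v hv with h2 | h2 <;> simp_all
    rcases hl with rfl | rfl <;> linarith
  obtain ⟨p, hp, hpx, hLp⟩ := hex 1 (Or.inl rfl)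
  obtain ⟨q, hq, hqx, hLq⟩ := hex (-1) (Or.inr rfl)
  have hpq : p ≠ q := by
    rintro rfl
    linarith
  have hpx' := lt_of_le_of_ne (T.coord_nonneg hx hp) hpx.symm
  have hqx' := lt_of_le_of_ne (T.coord_nonneg hx hq) hqx.symm
  set δ := min (T.coord p x) (T.coord q x) / 2 with hδ
  have hδ0 : 0 < δ := half_pos (lt_min hpx' hqx')
  have hδp : δ < T.coord p x := by
    have := min_le_left (T.coord p x) (T.coord q x)
    linarith
  have hδq : δ < T.coord q x := by
    have := min_le_right (T.coord p x) (T.coord q x)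
    linarith
  -- The labels differ by `2` along `p - q`, so the factor `1 / 2` gives unit speed.
  refine ⟨(1 / 2 : ℝ) • (p - q), {y | δ < T.coord p y} ∩ {y | δ < T.coord q y}, δ,
    (isOpen_lt continuous_const (T.continuous_coord p)).inter
      (isOpen_lt continuous_const (T.continuous_coord q)), ⟨hδp, hδq⟩, hδ0, ?_⟩
  rintro y hy ⟨hyp, hyq⟩ s hs
  have hs2 : |s * (1 / 2)| < δ := by
    rw [abs_mul, abs_of_pos (by norm_num : (0 : ℝ) < 1 / 2)]
    linarith [abs_nonneg s]
  have := T.shift_mem (L := L) hy hp hq hpq (hs2.trans hyp) (hs2.trans hyq)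
  rw [smul_smul]
  refine ⟨this.1, ?_⟩
  rw [this.2, hLp, hLq]
  ring

theorem mem_convexHull_iff_coord {S F : Finset E} (hS : S ∈ T.simplices) (hF : F ⊆ S) {x : E}
    (hx : x ∈ T.space) :
    x ∈ convexHull ℝ (F : Set E) ↔ ∀ u ∈ T.vertices, u ∉ F → T.coord u x = 0 :=
  ⟨fun h _ hu huF => T.coord_eq_zero_of_face hS hF h hu huF, T.mem_convexHull_of_coord hx⟩

/-! ### Change of centres -/

variable {T} {c c' : Finset E → E}

theorem IsCentre.interpolate_realize (hc : T.IsCentre c) (L : E → ℝ) {w : Finset E → ℝ}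
    (hw : w ∈ T.chainWeights) :
    T.interpolate L (T.realize c w) = ∑ F ∈ T.faces, w F * T.interpolate L (c F) := by
  obtain ⟨F₀, hF₀, -, htop⟩ := T.exists_top hw
  obtain ⟨-, S, hS, hFS⟩ := T.mem_faces.1 hF₀
  exact T.interpolate_weighted_sum L hS _ w c (fun F _ => hw.1 F) hw.2.2.1
    (fun F hF h0 => convexHull_mono (by exact_mod_cast (htop F h0).trans hFS) (hc F hF).1)

/-- The homeomorphism of the space of a triangulation that maps the subdivision with centres `c`
to the subdivision with centres `c'`. -/
noncomputable def IsCentre.transfer (hc : T.IsCentre c) (hc' : T.IsCentre c') :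
    T.space ≃ₜ T.space :=
  hc.homeomorph.symm.trans hc'.homeomorph

theorem IsCentre.exists_transfer_eq (hc : T.IsCentre c) (hc' : T.IsCentre c') (x : T.space) :
    ∃ w ∈ T.chainWeights, (x : E) = T.realize c w ∧ (hc.transfer hc' x : E) = T.realize c' w := by
  refine ⟨hc.homeomorph.symm x, (hc.homeomorph.symm x).2, ?_, rfl⟩
  rw [← hc.coe_homeomorph, Homeomorph.apply_symm_apply]

/-- The transfer keeps the weights, and their support alone decides which coordinates vanish. -/
theorem IsCentre.coord_transfer_eq_zero_iff (hc : T.IsCentre c) (hc' : T.IsCentre c')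
    (x : T.space) {u : E} (hu : u ∈ T.vertices) :
    T.coord u (hc.transfer hc' x) = 0 ↔ T.coord u x = 0 := by
  obtain ⟨w, hw, h1, h2⟩ := hc.exists_transfer_eq hc' x
  rw [h1, h2, hc.coord_realize_eq_zero_iff hw hu, hc'.coord_realize_eq_zero_iff hw hu]

theorem IsCentre.transfer_mem_convexHull_iff (hc : T.IsCentre c) (hc' : T.IsCentre c')
    (x : T.space) {S F : Finset E} (hS : S ∈ T.simplices) (hF : F ⊆ S) :
    (hc.transfer hc' x : E) ∈ convexHull ℝ (F : Set E) ↔ (x : E) ∈ convexHull ℝ (F : Set E) := by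
  rw [T.mem_convexHull_iff_coord hS hF (Subtype.coe_prop _), T.mem_convexHull_iff_coord hS hF x.2]
  exact forall₂_congr fun u hu => by rw [hc.coord_transfer_eq_zero_iff hc' x hu]

end Triangulation

/-! ### Complete flags -/

/-- A chain of finite sets that contain a given pair extends to a complete flag that starts with
this pair. -/
theorem exists_flag {ι : Type*} {n : ℕ} (hn : 1 ≤ n) {E S : Finset ι} (hE : E.card = 2)
    (hES : E ⊆ S) (hS : S.card = n + 1) (𝒞 : Finset (Finset ι)) (h𝒞 : ∀ C ∈ 𝒞, E ⊆ C ∧ C ⊆ S)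
    (hchain : ∀ C ∈ 𝒞, ∀ C' ∈ 𝒞, C ⊆ C' ∨ C' ⊆ C) :
    ∃ F : ℕ → Finset ι, F 1 = E ∧ F n = S ∧ (∀ i, 1 ≤ i → i ≤ n → F i ⊆ S ∧ (F i).card = i + 1) ∧
      (∀ i, 2 ≤ i → i ≤ n → F (i - 1) ⊆ F i) ∧ ∀ C ∈ 𝒞, ∃ i, 1 ≤ i ∧ i ≤ n ∧ F i = C := by
  classical
  induction n, hn using Nat.le_induction generalizing S 𝒞 with
  | base =>
    have hEq : E = S := Finset.eq_of_subset_of_card_le hES (by omega)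
    refine ⟨fun _ => S, hEq.symm, rfl, fun i h1 h2 =>
      ⟨subset_rfl, by rw [hS]; omega⟩, fun _ _ _ => subset_rfl, fun C hC => ⟨1, le_rfl, le_rfl, ?_⟩⟩
    exact subset_antisymm (hEq ▸ (h𝒞 C hC).1) (h𝒞 C hC).2
  | succ n hn ih =>
    -- `D` is the largest proper member of the chain, or the pair itself. Deleting from `S` a vertex
    -- outside `D` gives the next member of the flag without losing any set of the chain.
    obtain ⟨D, hD, hmax⟩ := (insert E (𝒞.filter (· ≠ S))).exists_max_image Finset.card
      ⟨E, Finset.mem_insert_self _ _⟩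
    have hsub : ∀ C ∈ 𝒞, C ≠ S → C ⊆ D := by
      intro C hC hCS
      have hCm : C ∈ insert E (𝒞.filter (· ≠ S)) := by simp [hC, hCS]
      have hle := hmax C hCm
      rcases Finset.mem_insert.1 hD with rfl | hD'
      · exact (Finset.eq_of_subset_of_card_le (h𝒞 C hC).1 hle).ge
      · rcases hchain C hC D (Finset.mem_filter.1 hD').1 with h | h
        · exact h
        · exact (Finset.eq_of_subset_of_card_le h hle).ge
    have hED : E ⊆ D := by
      rcases Finset.mem_insert.1 hD with rfl | hD'
      · exact subset_rfl
      · exact (h𝒞 D (Finset.mem_filter.1 hD').1).1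
    have hDS : D ⊂ S := by
      rcases Finset.mem_insert.1 hD with rfl | hD'
      · exact lt_of_le_of_ne hES fun h => by rw [← h] at hS; omega
      · rw [Finset.mem_filter] at hD'
        exact lt_of_le_of_ne (h𝒞 D hD'.1).2 hD'.2
    obtain ⟨v, hvS, hvD⟩ := Finset.exists_of_ssubset hDS
    have hsubE : ∀ C, C ⊆ D → C ⊆ S.erase v := fun C hC u hu =>
      Finset.mem_erase.2 ⟨fun h => hvD (h ▸ hC hu), hDS.1 (hC hu)⟩
    obtain ⟨F, hF1, hFn, hFc, hFi, hFC⟩ := ih (S := S.erase v) (hsubE E hED)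
      (by rw [Finset.card_erase_of_mem hvS]; omega) (𝒞.filter (· ≠ S))
      (fun C hC => by
        rw [Finset.mem_filter] at hC
        exact ⟨(h𝒞 C hC.1).1, hsubE C (hsub C hC.1 hC.2)⟩)
      (fun C hC C' hC' => hchain C (Finset.mem_filter.1 hC).1 C' (Finset.mem_filter.1 hC').1)
    refine ⟨fun i => if i ≤ n then F i else S, by simp [hn, hF1], by simp, fun i h1 h2 => ?_,
      fun i h1 h2 => ?_, fun C hC => ?_⟩
    · dsimp only
      split_ifs with h
      · exact ⟨(hFc i h1 h).1.trans (Finset.erase_subset _ _), (hFc i h1 h).2⟩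
      · exact ⟨subset_rfl, by omega⟩
    · dsimp only
      rw [if_pos (by omega : i - 1 ≤ n)]
      split_ifs with h
      · exact hFi i h1 h
      · exact (hFc (i - 1) (by omega) (by omega)).1.trans (Finset.erase_subset _ _)
    · by_cases hCS : C = S
      · exact ⟨n + 1, by omega, le_rfl, by simp [hCS]⟩
      · obtain ⟨i, h1, h2, h3⟩ := hFC C (Finset.mem_filter.2 ⟨hC, hCS⟩)
        exact ⟨i, h1, by omega, by simp [h2, h3]⟩

/-! ### Mixed faces and K-resistars as subcomplexes -/

/-- The face with vertices `F` has vertices with both labels `-1` and `+1`. -/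
def IsMixed {d : ℕ} (𝓜 : Pt d → SignType) (F : Finset (Pt d)) : Prop :=
  ∃ v ∈ F, ∃ w ∈ F, 𝓜 v = -1 ∧ 𝓜 w = 1

section

variable {d : ℕ} {𝓜 : Pt d → SignType} {b : Pt d → Pt d → Pt d}

theorem IsMixed.mono {F G : Finset (Pt d)} (h : IsMixed 𝓜 F) (hFG : F ⊆ G) : IsMixed 𝓜 G := by
  obtain ⟨v, hv, w, hw, h⟩ := h
  exact ⟨v, hFG hv, w, hFG hw, h⟩

theorem IsMixed.nonempty {F : Finset (Pt d)} (h : IsMixed 𝓜 F) : F.Nonempty := by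
  obtain ⟨v, hv, -⟩ := h
  exact ⟨v, hv⟩

theorem mem_boundaryPoints {F : Finset (Pt d)} {p : Pt d} :
    p ∈ boundaryPoints 𝓜 b F ↔ ∃ v ∈ F, ∃ w ∈ F, 𝓜 v = -1 ∧ 𝓜 w = 1 ∧ b v w = p := by
  simp only [boundaryPoints, Finset.mem_image, Finset.mem_filter, Finset.mem_product, Prod.exists]
  constructor
  · rintro ⟨v, w, ⟨⟨hv, hw⟩, h1, h2⟩, h⟩
    exact ⟨v, hv, w, hw, h1, h2, h⟩
  · rintro ⟨v, hv, w, hw, h1, h2, h⟩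
    exact ⟨v, w, ⟨⟨hv, hw⟩, h1, h2⟩, h⟩

theorem boundaryPoints_nonempty {F : Finset (Pt d)} :
    (boundaryPoints 𝓜 b F).Nonempty ↔ IsMixed 𝓜 F := by
  constructor
  · rintro ⟨p, hp⟩
    obtain ⟨v, hv, w, hw, h1, h2, -⟩ := mem_boundaryPoints.1 hp
    exact ⟨v, hv, w, hw, h1, h2⟩
  · rintro ⟨v, hv, w, hw, h1, h2⟩
    exact ⟨_, mem_boundaryPoints.2 ⟨v, hv, w, hw, h1, h2, rfl⟩⟩

theorem IsBoundaryPoint.exists_eq {n : ℕ} {v w p : Pt d} (h : IsBoundaryPoint 𝓜 n v w p) :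
    ∃ t : ℝ, 0 < t ∧ t < 1 ∧ p = (1 - t) • v + t • w := by
  obtain ⟨i, hi, -, -, rfl⟩ := h
  have hn : (0 : ℝ) < n := by exact_mod_cast (Nat.zero_le i).trans_lt hi
  have hi' : (i : ℝ) + 1 ≤ n := by exact_mod_cast hi
  refine ⟨(i + 1 / 2) / n, by positivity, by rw [div_lt_one hn]; linarith, ?_⟩
  module

open Classical in
/-- The barycentre of the boundary points on a face with vertices of both signs, and the
barycentre of the vertices of any other face. -/
noncomputable def resistarCentre (𝓜 : Pt d → SignType) (b : Pt d → Pt d → Pt d)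
    (F : Finset (Pt d)) : Pt d :=
  if IsMixed 𝓜 F then boundaryBarycentre 𝓜 b F else F.centroid ℝ id

theorem resistarCentre_of_isMixed {F : Finset (Pt d)} (h : IsMixed 𝓜 F) :
    resistarCentre 𝓜 b F = boundaryBarycentre 𝓜 b F := if_pos h

theorem resistarCentre_of_not_isMixed {F : Finset (Pt d)} (h : ¬ IsMixed 𝓜 F) :
    resistarCentre 𝓜 b F = F.centroid ℝ id := if_neg h

/-- The boundary point of each edge of the triangulation is in its interior. -/
def IsEdgeChoice (T : Triangulation (Pt d)) (𝓜 : Pt d → SignType) (b : Pt d → Pt d → Pt d) :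
    Prop :=
  ∀ S ∈ T.simplices, ∀ v ∈ S, ∀ w ∈ S, 𝓜 v = -1 → 𝓜 w = 1 →
    ∃ t : ℝ, 0 < t ∧ t < 1 ∧ b v w = (1 - t) • v + t • w

variable {T : Triangulation (Pt d)}

theorem eq_neg_one_or_eq_one (h𝓜 : ∀ v ∈ T.vertices, 𝓜 v ≠ 0) {v : Pt d} (hv : v ∈ T.vertices) :
    𝓜 v = -1 ∨ 𝓜 v = 1 := by
  have := h𝓜 v hv
  generalize 𝓜 v = s at this ⊢
  cases s <;> simp_all

theorem IsEdgeChoice.mem_convexHull (hb : IsEdgeChoice T 𝓜 b) {S F : Finset (Pt d)}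
    (hS : S ∈ T.simplices) (hF : F ⊆ S) {p : Pt d} (hp : p ∈ boundaryPoints 𝓜 b F) :
    p ∈ convexHull ℝ (F : Set (Pt d)) := by
  obtain ⟨v, hv, w, hw, h1, h2, rfl⟩ := mem_boundaryPoints.1 hp
  obtain ⟨t, ht0, ht1, ht⟩ := hb S hS v (hF hv) w (hF hw) h1 h2
  rw [ht]
  exact (convex_convexHull ℝ _) (subset_convexHull ℝ _ hv) (subset_convexHull ℝ _ hw)
    (by linarith) ht0.le (by ring)

/-- Every vertex of a mixed face is joined to a vertex of the face with the opposite label, and the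
boundary point of that edge has a positive coordinate there; averaging keeps it positive. -/
theorem IsEdgeChoice.isCentre (hb : IsEdgeChoice T 𝓜 b) (h𝓜 : ∀ v ∈ T.vertices, 𝓜 v ≠ 0) :
    T.IsCentre (resistarCentre 𝓜 b) := by
  intro F hF
  obtain ⟨hne, S, hS, hFS⟩ := T.mem_faces.1 hF
  have hFS' : convexHull ℝ (F : Set (Pt d)) ⊆ convexHull ℝ (S : Set (Pt d)) :=
    convexHull_mono (by exact_mod_cast hFS)
  have hSv := T.subset_vertices S hS
  by_cases hmix : IsMixed 𝓜 F
  · rw [resistarCentre_of_isMixed hmix, boundaryBarycentre]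
    have hmem := fun p hp => hb.mem_convexHull hS hFS (p := p) hp
    refine ⟨Triangulation.centroid_mem (boundaryPoints_nonempty.2 hmix) (convex_convexHull ℝ _)
      hmem, fun u hu => ?_⟩
    have key : ∃ p ∈ boundaryPoints 𝓜 b F, 0 < T.coord u p := by
      have hedge : ∀ v ∈ F, ∀ w ∈ F, 𝓜 v = -1 → 𝓜 w = 1 → (u = v ∨ u = w) →
          0 < T.coord u (b v w) := by
        intro v hv w hw h1 h2 h
        obtain ⟨t, ht0, ht1, ht⟩ := hb S hS v (hFS hv) w (hFS hw) h1 h2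
        have hv' := subset_convexHull ℝ (S : Set (Pt d)) (hFS hv)
        have hw' := subset_convexHull ℝ (S : Set (Pt d)) (hFS hw)
        have n1 := T.coord_nonneg (T.mem_space.2 ⟨S, hS, hv'⟩) (hSv (hFS hu))
        have n2 := T.coord_nonneg (T.mem_space.2 ⟨S, hS, hw'⟩) (hSv (hFS hu))
        rw [ht, T.coord_combo hS hv' hw' (by linarith) ht0.le (by ring) (hSv (hFS hu))]
        rcases h with rfl | rfl
        · rw [T.coord_self hS (hFS hu)] at n1 ⊢
          have := mul_nonneg ht0.le n2
          linarith
        · rw [T.coord_self hS (hFS hu)] at n2 ⊢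
          have := mul_nonneg (sub_nonneg.2 ht1.le) n1
          linarith
      obtain ⟨v, hv, w, hw, h1, h2⟩ := hmix
      rcases eq_neg_one_or_eq_one h𝓜 (hSv (hFS hu)) with h | h
      · exact ⟨_, mem_boundaryPoints.2 ⟨u, hu, w, hw, h, h2, rfl⟩,
          hedge u hu w hw h h2 (Or.inl rfl)⟩
      · exact ⟨_, mem_boundaryPoints.2 ⟨v, hv, u, hu, h1, h, rfl⟩,
          hedge v hv u hu h1 h (Or.inr rfl)⟩
    obtain ⟨p, hp, hup⟩ := key
    exact T.coord_centroid_pos hS (fun p hp => hFS' (hmem p hp)) (hSv (hFS hu)) hp hup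
  · rw [resistarCentre_of_not_isMixed hmix]
    exact ⟨Triangulation.centroid_mem hne (convex_convexHull ℝ _)
      fun p hp => subset_convexHull ℝ _ hp, fun u hu => T.coord_centroid_pos hS
        (fun p hp => subset_convexHull ℝ _ (hFS hp)) (hSv (hFS hu)) hu
        (by rw [T.coord_self hS (hFS hu)]; exact one_pos)⟩

theorem isEdgeChoice_midpoint (T : Triangulation (Pt d)) (𝓜 : Pt d → SignType) :
    IsEdgeChoice T 𝓜 (midpoint ℝ) := fun _ _ v _ w _ _ _ =>
  ⟨1 / 2, by norm_num, by norm_num, by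
    rw [midpoint_eq_smul_add, smul_add, invOf_eq_inv]; norm_num⟩

/-- The label of a point as a real number. -/
def realLabel (𝓜 : Pt d → SignType) (v : Pt d) : ℝ := (𝓜 v : ℝ)

theorem interpolate_resistarCentre_midpoint_of_isMixed {F : Finset (Pt d)} (hF : F ∈ T.faces)
    (h : IsMixed 𝓜 F) :
    T.interpolate (realLabel 𝓜) (resistarCentre 𝓜 (midpoint ℝ) F) = 0 := by
  obtain ⟨-, S, hS, hFS⟩ := T.mem_faces.1 hF
  rw [resistarCentre_of_isMixed h, boundaryBarycentre]
  refine T.interpolate_centroid _ hS (boundaryPoints_nonempty.2 h) (fun p hp => convexHull_mono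
    (by exact_mod_cast hFS) ((isEdgeChoice_midpoint T 𝓜).mem_convexHull hS hFS hp)) fun p hp => ?_
  obtain ⟨v, hv, w, hw, h1, h2, rfl⟩ := mem_boundaryPoints.1 hp
  rw [midpoint_eq_smul_add, smul_add, T.interpolate_combo _ hS (subset_convexHull ℝ _ (hFS hv))
    (subset_convexHull ℝ _ (hFS hw)) (by simp) (by simp) (by norm_num),
    T.interpolate_vertex _ hS (hFS hv), T.interpolate_vertex _ hS (hFS hw), realLabel, realLabel,
    h1, h2]
  simp

theorem exists_label_of_not_isMixed (h𝓜 : ∀ v ∈ T.vertices, 𝓜 v ≠ 0) {F : Finset (Pt d)}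
    (hF : F ∈ T.faces) (h : ¬ IsMixed 𝓜 F) :
    ∃ l : ℝ, (l = 1 ∨ l = -1) ∧ (∀ v ∈ F, realLabel 𝓜 v = l) ∧
      T.interpolate (realLabel 𝓜) (resistarCentre 𝓜 b F) = l := by
  obtain ⟨⟨u, hu⟩, S, hS, hFS⟩ := T.mem_faces.1 hF
  have hv : ∀ v ∈ F, 𝓜 v = -1 ∨ 𝓜 v = 1 := fun v hv =>
    eq_neg_one_or_eq_one h𝓜 (T.subset_vertices S hS (hFS hv))
  have heq : ∀ v ∈ F, 𝓜 v = 𝓜 u := by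
    intro v hvF
    rcases hv v hvF with h1 | h1 <;> rcases hv u hu with h2 | h2
    · rw [h1, h2]
    · exact absurd ⟨v, hvF, u, hu, h1, h2⟩ h
    · exact absurd ⟨u, hu, v, hvF, h2, h1⟩ h
    · rw [h1, h2]
  have hl : ∀ v ∈ F, realLabel 𝓜 v = realLabel 𝓜 u := fun v hv => by
    rw [realLabel, realLabel, heq v hv]
  refine ⟨realLabel 𝓜 u, ?_, hl, ?_⟩
  · rcases hv u hu with h2 | h2 <;> simp [realLabel, h2]
  · rw [resistarCentre_of_not_isMixed h]
    exact T.interpolate_centroid _ hS ⟨u, hu⟩ (fun p hp => subset_convexHull ℝ _ (hFS hp))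
      fun p hp => by rw [T.interpolate_vertex _ hS (hFS hp), hl p hp]

/-- In the subdivision whose centres are computed from the midpoints of the edges, the zero set of
the interpolated labels is the subcomplex of the chains of mixed faces. -/
theorem interpolate_realize_midpoint_eq_zero_iff (h𝓜 : ∀ v ∈ T.vertices, 𝓜 v ≠ 0)
    {w : Finset (Pt d) → ℝ} (hw : w ∈ T.chainWeights) :
    T.interpolate (realLabel 𝓜) (T.realize (resistarCentre 𝓜 (midpoint ℝ)) w) = 0 ↔
      ∀ F, w F ≠ 0 → IsMixed 𝓜 F := by
  have hface : ∀ F, w F ≠ 0 → F ∈ T.faces := fun F h => by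
    by_contra h'
    exact h (hw.2.1 F h')
  rw [((isEdgeChoice_midpoint T 𝓜).isCentre h𝓜).interpolate_realize _ hw]
  constructor
  · intro h0 F hF
    -- Two non-mixed faces of a chain have a common vertex, hence the same label `l`. Multiplied by
    -- `l`, the interpolation is `1` at the non-mixed centres and `0` at the mixed ones, so nothing
    -- cancels.
    by_contra hmix
    obtain ⟨l, hl, hlF, hlc⟩ :=
      exists_label_of_not_isMixed (b := midpoint ℝ) h𝓜 (hface F hF) hmix
    have hll : l * l = 1 := by rcases hl with rfl | rfl <;> norm_num
    have hpos : 0 < ∑ G ∈ T.faces, w G *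
        (l * T.interpolate (realLabel 𝓜) (resistarCentre 𝓜 (midpoint ℝ) G)) := by
      refine Finset.sum_pos' (fun G hG => ?_) ⟨F, hface F hF, ?_⟩
      · by_cases hwG : w G = 0
        · rw [hwG, zero_mul]
        refine mul_nonneg (hw.1 G) ?_
        by_cases hGm : IsMixed 𝓜 G
        · rw [interpolate_resistarCentre_midpoint_of_isMixed hG hGm, mul_zero]
        obtain ⟨l', -, hlG, hlc'⟩ := exists_label_of_not_isMixed (b := midpoint ℝ) h𝓜 hG hGm
        have hll' : l' = l := by
          by_cases h1 : F ⊆ G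
          · obtain ⟨v, hv⟩ := (T.mem_faces.1 (hface F hF)).1
            exact (hlG v (h1 hv)).symm.trans (hlF v hv)
          by_cases h2 : G ⊆ F
          · obtain ⟨v, hv⟩ := (T.mem_faces.1 hG).1
            exact (hlG v hv).symm.trans (hlF v (h2 hv))
          · exact absurd (hw.2.2.2 F G h1 h2) (mul_ne_zero hF hwG)
        rw [hlc', hll', hll]
        exact zero_le_one
      · rw [hlc, hll, mul_one]
        exact lt_of_le_of_ne (hw.1 F) hF.symm
    have e : ∑ G ∈ T.faces, w G *
        (l * T.interpolate (realLabel 𝓜) (resistarCentre 𝓜 (midpoint ℝ) G)) =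
        l * ∑ G ∈ T.faces, w G *
          T.interpolate (realLabel 𝓜) (resistarCentre 𝓜 (midpoint ℝ) G) := by
      rw [Finset.mul_sum]
      exact Finset.sum_congr rfl fun G _ => by ring
    rw [e, h0, mul_zero] at hpos
    exact lt_irrefl _ hpos
  · intro h
    refine Finset.sum_eq_zero fun F hF => ?_
    by_cases h0 : w F = 0
    · rw [h0, zero_mul]
    · rw [interpolate_resistarCentre_midpoint_of_isMixed hF (h F h0), mul_zero]

/-- The K-resistar of a simplex is the subcomplex of the chains of its mixed faces. -/
theorem mem_kResistar_iff (hd : 1 ≤ d) (hb : IsEdgeChoice T 𝓜 b)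
    (h𝓜 : ∀ v ∈ T.vertices, 𝓜 v ≠ 0) {S : Finset (Pt d)} (hS : S ∈ T.simplices)
    (hcard : S.card = d + 1) {x : Pt d} :
    x ∈ kResistar 𝓜 b S ↔ ∃ w ∈ T.chainWeights, x = T.realize (resistarCentre 𝓜 b) w ∧
      ∀ F, w F ≠ 0 → F ⊆ S ∧ IsMixed 𝓜 F := by
  classical
  have hc := hb.isCentre h𝓜
  simp only [kResistar, Set.mem_iUnion, exists_prop]
  constructor
  · rintro ⟨F, hF, hx⟩
    have hmono : ∀ i j, 1 ≤ i → i ≤ j → j ≤ d → F i ⊆ F j := by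
      intro i j hi hij
      induction j, hij using Nat.le_induction with
      | base => exact fun _ => subset_rfl
      | succ j hij ih => exact fun h => (ih (by omega)).trans (hF.incl (j + 1) (by omega) h)
    have hmix : ∀ i, 1 ≤ i → i ≤ d → IsMixed 𝓜 (F i) := fun i h1 h2 =>
      (boundaryPoints_nonempty.1 hF.edge).mono (hmono 1 i le_rfl h1 h2)
    have hface : ∀ i, 1 ≤ i → i ≤ d → F i ∈ T.faces := fun i h1 h2 =>
      T.mem_faces.2 ⟨(hmix i h1 h2).nonempty, S, hS, (hF.face i h1 h2).1⟩
    -- Weights supported on one fixed flag automatically form a chain, so their realizations are a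
    -- convex set; it contains the barycentres, hence their convex hull.
    set A : Set (Pt d) := {x | ∃ w ∈ T.chainWeights, x = T.realize (resistarCentre 𝓜 b) w ∧
      ∀ G, w G ≠ 0 → ∃ i, 1 ≤ i ∧ i ≤ d ∧ G = F i} with hA
    have hchain : ∀ w : Finset (Pt d) → ℝ, (∀ G, w G ≠ 0 → ∃ i, 1 ≤ i ∧ i ≤ d ∧ G = F i) →
        ∀ G G', ¬ G ⊆ G' → ¬ G' ⊆ G → w G * w G' = 0 := by
      intro w hw G G' h1 h2
      by_contra h0
      obtain ⟨i, hi1, hi2, rfl⟩ := hw G (left_ne_zero_of_mul h0)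
      obtain ⟨j, hj1, hj2, rfl⟩ := hw G' (right_ne_zero_of_mul h0)
      rcases le_total i j with h | h
      · exact h1 (hmono i j hi1 h hj2)
      · exact h2 (hmono j i hj1 h hi2)
    have hAconv : Convex ℝ A := by
      rintro _ ⟨w, hw, rfl, hwF⟩ _ ⟨w', hw', rfl, hwF'⟩ s t hs ht hst
      have hsupp : ∀ G, s * w G + t * w' G ≠ 0 → ∃ i, 1 ≤ i ∧ i ≤ d ∧ G = F i := by
        intro G hG
        by_cases h1 : w G = 0
        · refine hwF' G fun h2 => hG ?_
          rw [h1, h2, mul_zero, mul_zero, add_zero]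
        · exact hwF G h1
      refine ⟨fun G => s * w G + t * w' G, ⟨fun G => ?_, fun G hG => ?_, ?_, hchain _ hsupp⟩, ?_,
        hsupp⟩
      · exact add_nonneg (mul_nonneg hs (hw.1 G)) (mul_nonneg ht (hw'.1 G))
      · simp only [hw.2.1 G hG, hw'.2.1 G hG, mul_zero, add_zero]
      · rw [Finset.sum_add_distrib, ← Finset.mul_sum, ← Finset.mul_sum, hw.2.2.1, hw'.2.2.1]
        linarith
      · simp only [Triangulation.realize, Finset.smul_sum, smul_smul, add_smul,
          Finset.sum_add_distrib]
    have hxA : x ∈ A := by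
      refine convexHull_min ?_ hAconv hx
      rintro _ ⟨i, ⟨h1, h2⟩, rfl⟩
      have hsupp : ∀ G, (if G = F i then (1 : ℝ) else 0) ≠ 0 → ∃ i, 1 ≤ i ∧ i ≤ d ∧ G = F i :=
        fun G hG => ⟨i, h1, h2, by
          by_contra h
          exact hG (if_neg h)⟩
      refine ⟨fun G => if G = F i then 1 else 0, ⟨fun G => ?_, fun G hG => ?_, ?_, hchain _ hsupp⟩,
        ?_, hsupp⟩
      · dsimp only; split_ifs
        exacts [zero_le_one, le_rfl]
      · exact if_neg fun h : G = F i => hG (h ▸ hface i h1 h2)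
      · rw [Finset.sum_ite_eq' T.faces (F i), if_pos (hface i h1 h2)]
      · simp only [Triangulation.realize, ite_smul, one_smul, zero_smul]
        rw [Finset.sum_ite_eq' T.faces (F i), if_pos (hface i h1 h2),
          resistarCentre_of_isMixed (hmix i h1 h2)]
    obtain ⟨w, hw, hxw, hwF⟩ := hxA
    refine ⟨w, hw, hxw, fun G hG => ?_⟩
    obtain ⟨i, h1, h2, rfl⟩ := hwF G hG
    exact ⟨(hF.face i h1 h2).1, hmix i h1 h2⟩
  · rintro ⟨w, hw, rfl, hwF⟩
    set 𝒞 := T.faces.filter (fun F => w F ≠ 0) with h𝒞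
    have hchain : ∀ C ∈ 𝒞, ∀ C' ∈ 𝒞, C ⊆ C' ∨ C' ⊆ C := by
      intro C hC C' hC'
      by_contra! h
      exact mul_ne_zero (Finset.mem_filter.1 hC).2 (Finset.mem_filter.1 hC').2
        (hw.2.2.2 C C' h.1 h.2)
    obtain ⟨F₁, hF₁, hF₁w, -⟩ := T.exists_top hw
    obtain ⟨F₀, hF₀, hmin⟩ := 𝒞.exists_min_image Finset.card
      ⟨F₁, Finset.mem_filter.2 ⟨hF₁, hF₁w⟩⟩
    have hbot : ∀ C ∈ 𝒞, F₀ ⊆ C := by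
      intro C hC
      rcases hchain F₀ hF₀ C hC with h | h
      · exact h
      · exact (Finset.eq_of_subset_of_card_le h (hmin C hC)).ge
    -- The smallest face of the support is mixed, so it contains an edge with both labels. A
    -- complete flag from this edge through the support supplies a chain of the K-resistar.
    have hF₀' := hwF F₀ (Finset.mem_filter.1 hF₀).2
    obtain ⟨v, hv, u, hu, h1, h2⟩ := hF₀'.2
    have hvu : v ≠ u := by
      rintro rfl
      rw [h1] at h2
      exact absurd h2 (by decide)
    have hE : {v, u} ⊆ F₀ := by
      intro z hz
      rcases Finset.mem_insert.1 hz with rfl | hz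
      · exact hv
      · rwa [Finset.mem_singleton.1 hz]
    obtain ⟨F, hF1, hFd, hFc, hFi, hFC⟩ := exists_flag hd (Finset.card_pair hvu)
      (hE.trans hF₀'.1) hcard 𝒞
      (fun C hC => ⟨hE.trans (hbot C hC), (hwF C (Finset.mem_filter.1 hC).2).1⟩) hchain
    refine ⟨F, ⟨hFc, hFi, ?_, hFd⟩, ?_⟩
    · rw [hF1, boundaryPoints_nonempty]
      exact ⟨v, by simp, u, by simp, h1, h2⟩
    · have e : T.realize (resistarCentre 𝓜 b) w = ∑ G ∈ 𝒞, w G • resistarCentre 𝓜 b G := by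
        rw [Triangulation.realize, h𝒞, Finset.sum_filter]
        refine Finset.sum_congr rfl fun G _ => ?_
        split_ifs with h
        · rfl
        · rw [not_not.1 h, zero_smul]
      rw [e]
      refine (convex_convexHull ℝ _).sum_mem (fun G _ => hw.1 G) ?_ fun G hG => ?_
      · rw [h𝒞, Finset.sum_filter_ne_zero]; exact hw.2.2.1
      · obtain ⟨i, hi1, hi2, rfl⟩ := hFC G hG
        rw [resistarCentre_of_isMixed (hwF _ (Finset.mem_filter.1 hG).2).2]
        exact subset_convexHull ℝ _ ⟨i, ⟨hi1, hi2⟩, rfl⟩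

/-- The homeomorphism of the space of the triangulation that maps the K-resistars to the zero set
of the interpolated labels. -/
noncomputable def IsEdgeChoice.straighten (hb : IsEdgeChoice T 𝓜 b)
    (h𝓜 : ∀ v ∈ T.vertices, 𝓜 v ≠ 0) : T.space ≃ₜ T.space :=
  (hb.isCentre h𝓜).transfer ((isEdgeChoice_midpoint T 𝓜).isCentre h𝓜)

/-- Apart from membership in `S`, the condition does not depend on `S`: agreement of K-resistars on
shared points follows at once. -/
theorem IsEdgeChoice.mem_kResistar_iff_straighten (hd : 1 ≤ d) (hb : IsEdgeChoice T 𝓜 b)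
    (h𝓜 : ∀ v ∈ T.vertices, 𝓜 v ≠ 0) {S : Finset (Pt d)} (hS : S ∈ T.simplices)
    (hcard : S.card = d + 1) (x : T.space) :
    (x : Pt d) ∈ kResistar 𝓜 b S ↔ (x : Pt d) ∈ convexHull ℝ (S : Set (Pt d)) ∧
      T.interpolate (realLabel 𝓜) (hb.straighten h𝓜 x) = 0 := by
  have hc := hb.isCentre h𝓜
  obtain ⟨w, hw, h1, h2⟩ :=
    hc.exists_transfer_eq ((isEdgeChoice_midpoint T 𝓜).isCentre h𝓜) x
  rw [mem_kResistar_iff hd hb h𝓜 hS hcard, IsEdgeChoice.straighten, h2,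
    interpolate_realize_midpoint_eq_zero_iff h𝓜 hw]
  constructor
  · rintro ⟨w', hw', hx, hw'F⟩
    obtain rfl : w = w' := hc.realize_injOn hw hw' (h1.symm.trans hx)
    exact ⟨by rw [h1]; exact hc.realize_mem_convexHull hw fun G hG => (hw'F G hG).1,
      fun F hF => (hw'F F hF).2⟩
  · rintro ⟨hxS, hmix⟩
    refine ⟨w, hw, h1, fun F hF => ⟨fun u hu => ?_, hmix F hF⟩⟩
    have hFf : F ∈ T.faces := by
      by_contra h'
      exact hF (hw.2.1 F h')
    obtain ⟨-, S', hS', hFS'⟩ := T.mem_faces.1 hFf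
    have huv := T.subset_vertices S' hS' (hFS' hu)
    by_contra huS
    have h0 := T.coord_eq_zero hS hxS huv huS
    rw [h1, hc.coord_realize_eq_zero_iff hw huv] at h0
    exact h0 F hF hu

theorem kResistar_subset_convexHull (hd : 1 ≤ d) (hb : IsEdgeChoice T 𝓜 b)
    (h𝓜 : ∀ v ∈ T.vertices, 𝓜 v ≠ 0) {S : Finset (Pt d)} (hS : S ∈ T.simplices)
    (hcard : S.card = d + 1) : kResistar 𝓜 b S ⊆ convexHull ℝ (S : Set (Pt d)) := by
  intro x hx
  obtain ⟨w, hw, rfl, h⟩ := (mem_kResistar_iff hd hb h𝓜 hS hcard).1 hx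
  exact (hb.isCentre h𝓜).realize_mem_convexHull hw fun G hG => (h G hG).1

theorem IsMixed.of_mem_kResistar {S : Finset (Pt d)} {x : Pt d} (hd : 1 ≤ d)
    (hx : x ∈ kResistar 𝓜 b S) : IsMixed 𝓜 S := by
  simp only [kResistar, Set.mem_iUnion, exists_prop] at hx
  obtain ⟨F, hF, -⟩ := hx
  exact (boundaryPoints_nonempty.1 hF.edge).mono (hF.face 1 le_rfl hd).1

end

/-! ### The K-resistar approximation on the grid -/

theorem card_of_mem_kSimplices {d nG : ℕ} (hnG : 2 ≤ nG) {S : Finset (Pt d)}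
    (hS : S ∈ kSimplices d nG) : S.card = d + 1 := by
  classical
  obtain ⟨k, P, -, rfl⟩ := hS
  rw [kuhnVertices, Finset.card_image_of_injective _ (kuhnVertex_injective hnG k P)]
  simp

section Grid

variable {d nG : ℕ} {hnG : 2 ≤ nG} {𝓜 : Pt d → SignType} {b : Pt d → Pt d → Pt d}

theorem mem_kResistarGrid_iff (hd : 1 ≤ d) (hb : IsEdgeChoice (kuhnTriangulation d nG hnG) 𝓜 b)
    (h𝓜 : ∀ v ∈ (kuhnTriangulation d nG hnG).vertices, 𝓜 v ≠ 0) {x : Pt d} :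
    x ∈ kResistarGrid nG 𝓜 b ↔ ∃ hx : x ∈ (kuhnTriangulation d nG hnG).space,
      (kuhnTriangulation d nG hnG).interpolate (realLabel 𝓜) (hb.straighten h𝓜 ⟨x, hx⟩) = 0 := by
  simp only [kResistarGrid, Set.mem_iUnion, exists_prop]
  constructor
  · rintro ⟨S, ⟨hS, -⟩, hx⟩
    have hcard := card_of_mem_kSimplices hnG hS
    have hxs := (kuhnTriangulation d nG hnG).mem_space.2
      ⟨S, hS, kResistar_subset_convexHull hd hb h𝓜 hS hcard hx⟩
    exact ⟨hxs, ((hb.mem_kResistar_iff_straighten hd h𝓜 hS hcard ⟨x, hxs⟩).1 hx).2⟩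
  · rintro ⟨hxs, h0⟩
    obtain ⟨S, hS, hx⟩ := (kuhnTriangulation d nG hnG).mem_space.1 hxs
    have hxR := (hb.mem_kResistar_iff_straighten hd h𝓜 hS (card_of_mem_kSimplices hnG hS)
      ⟨x, hxs⟩).2 ⟨hx, h0⟩
    exact ⟨S, ⟨hS, boundaryPoints_nonempty.2 (IsMixed.of_mem_kResistar hd hxR)⟩, hxR⟩

theorem hasConsistentCharts (hd : 1 ≤ d) (hb : IsEdgeChoice (kuhnTriangulation d nG hnG) 𝓜 b)
    (h𝓜 : ∀ v ∈ (kuhnTriangulation d nG hnG).vertices, 𝓜 v ≠ 0) :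
    HasConsistentCharts nG 𝓜 b := by
  classical
  set T := kuhnTriangulation d nG hnG with hT
  have hcard : ∀ S ∈ T.simplices, S.card = d + 1 := fun S hS => card_of_mem_kSimplices hnG hS
  have hℓex : ∀ S : Finset (Pt d), ∃ ℓ : Pt d →ᵃ[ℝ] ℝ, S ∈ kSimplices d nG →
      ∀ v ∈ S, ℓ v = realLabel 𝓜 v := by
    intro S
    by_cases hS : S ∈ kSimplices d nG
    · obtain ⟨ℓ, hℓ⟩ := exists_affineMap_eq_on_kSimplex hnG hS (realLabel 𝓜)
      exact ⟨ℓ, fun _ => hℓ⟩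
    · exact ⟨0, fun h => absurd h hS⟩
  choose ℓ hℓ using hℓex
  set Φ := hb.straighten h𝓜 with hΦ
  -- A single map serves as the chart of every simplex, so consistency across simplices is
  -- immediate. Its values outside the cube are irrelevant.
  set φ : Pt d → Pt d := fun x => if h : x ∈ T.space then Φ ⟨x, h⟩ else x with hφ
  have hφx : ∀ x : T.space, φ x = Φ x := fun x => dif_pos x.2
  have hφcont : ContinuousOn φ T.space := by
    rw [continuousOn_iff_continuous_domRestrict]
    exact (continuous_subtype_val.comp Φ.continuous).congr fun x => (hφx x).symm
  have hφinj : Set.InjOn φ T.space := by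
    intro x hx y hy hxy
    have h1 := hφx ⟨x, hx⟩
    have h2 := hφx ⟨y, hy⟩
    simp only at h1 h2
    rw [h1, h2] at hxy
    exact congrArg Subtype.val (Φ.injective (Subtype.ext hxy))
  have hconv : ∀ S ∈ T.simplices, kResistar 𝓜 b S ⊆ convexHull ℝ (S : Set (Pt d)) :=
    fun S hS => kResistar_subset_convexHull hd hb h𝓜 hS (hcard S hS)
  have hspace : ∀ S ∈ T.simplices, convexHull ℝ (S : Set (Pt d)) ⊆ T.space :=
    fun S hS x hx => T.mem_space.2 ⟨S, hS, hx⟩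
  have hiff : ∀ S ∈ T.simplices, ∀ x : T.space, (x : Pt d) ∈ kResistar 𝓜 b S ↔
      (x : Pt d) ∈ convexHull ℝ (S : Set (Pt d)) ∧ T.interpolate (realLabel 𝓜) (Φ x) = 0 :=
    fun S hS x => hb.mem_kResistar_iff_straighten hd h𝓜 hS (hcard S hS) x
  have hface : ∀ S ∈ T.simplices, ∀ F ⊆ S, ∀ x : T.space,
      (Φ x : Pt d) ∈ convexHull ℝ (F : Set (Pt d)) ↔ (x : Pt d) ∈ convexHull ℝ (F : Set (Pt d)) :=
    fun S hS F hF x => (hb.isCentre h𝓜).transfer_mem_convexHull_iff _ x hS hF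
  have hsub : ∀ S ∈ T.simplices, ∀ S' ∈ T.simplices,
      kResistar 𝓜 b S ∩ convexHull ℝ (S' : Set (Pt d)) ⊆
        kResistar 𝓜 b S' ∩ convexHull ℝ (S : Set (Pt d)) := by
    rintro S hS S' hS' x ⟨hx, hx'⟩
    have h := (hiff S hS ⟨x, hspace S' hS' hx'⟩).1 hx
    exact ⟨(hiff S' hS' ⟨x, hspace S' hS' hx'⟩).2 ⟨hx', h.2⟩, h.1⟩
  refine ⟨ℓ, fun _ => φ, fun S hS _ => ⟨fun v hv => ?_, ?_, ?_, fun F hF => ?_⟩,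
    fun S hS S' hS' => ⟨(hsub S hS S' hS').antisymm (hsub S' hS' S hS), fun _ _ => rfl⟩⟩
  · rw [hℓ S hS v hv, realLabel]
    constructor <;> intro h <;> rw [h] <;> simp
  · exact hφcont.mono ((hconv S hS).trans (hspace S hS))
  · exact hφinj.mono ((hconv S hS).trans (hspace S hS))
  · have hFS : convexHull ℝ (F : Set (Pt d)) ⊆ convexHull ℝ (S : Set (Pt d)) :=
      convexHull_mono (by exact_mod_cast hF)
    have hℓS : ∀ y ∈ convexHull ℝ (S : Set (Pt d)), ℓ S y = T.interpolate (realLabel 𝓜) y :=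
      fun y hy => T.affineMap_eq_interpolate _ hS (ℓ S) (hℓ S hS) hy
    ext y
    constructor
    · rintro ⟨x, ⟨hxR, hxF⟩, rfl⟩
      have hxs := hspace S hS (hFS hxF)
      have hyF := (hface S hS F hF ⟨x, hxs⟩).2 hxF
      have e := hφx ⟨x, hxs⟩
      simp only at e
      beta_reduce
      rw [e]
      exact ⟨hyF, by rw [hℓS _ (hFS hyF)]; exact ((hiff S hS ⟨x, hxs⟩).1 hxR).2⟩
    · rintro ⟨hyF, hy0⟩
      rw [hℓS _ (hFS hyF)] at hy0
      have hΦx : Φ (Φ.symm ⟨y, hspace S hS (hFS hyF)⟩) = ⟨y, hspace S hS (hFS hyF)⟩ :=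
        Φ.apply_symm_apply _
      set x := Φ.symm ⟨y, hspace S hS (hFS hyF)⟩ with hx
      have hxF : (x : Pt d) ∈ convexHull ℝ (F : Set (Pt d)) := by
        rw [← hface S hS F hF x, hΦx]
        exact hyF
      refine ⟨x, ⟨(hiff S hS x).2 ⟨hFS hxF, by rw [hΦx]; exact hy0⟩, hxF⟩, ?_⟩
      beta_reduce
      rw [hφx, hΦx]

/-- Coordinate `i` of `x` is a convex combination of the nonnegative coordinates `i` of the
vertices. So lying on a facet of the cube depends only on which barycentric coordinates vanish. -/
theorem apply_eq_zero_iff_coord {x : Pt d} (hx : x ∈ (kuhnTriangulation d nG hnG).space)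
    (i : Fin d) : x i = 0 ↔ ∀ v ∈ (kuhnTriangulation d nG hnG).vertices,
      (kuhnTriangulation d nG hnG).coord v x ≠ 0 → v i = 0 := by
  set T := kuhnTriangulation d nG hnG with hT
  have e : x i = ∑ v ∈ T.vertices, T.coord v x * v i := by
    conv_lhs => rw [← T.sum_coord_smul hx]
    simp [WithLp.ofLp_sum]
  rw [e, Finset.sum_eq_zero_iff_of_nonneg fun v hv =>
    mul_nonneg (T.coord_nonneg hx hv) (mem_unitCube_of_mem_vertices hv i).1]
  exact forall₂_congr fun v _ => by rw [mul_eq_zero, or_iff_not_imp_left]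

theorem apply_eq_one_iff_coord {x : Pt d} (hx : x ∈ (kuhnTriangulation d nG hnG).space)
    (i : Fin d) : x i = 1 ↔ ∀ v ∈ (kuhnTriangulation d nG hnG).vertices,
      (kuhnTriangulation d nG hnG).coord v x ≠ 0 → v i = 1 := by
  set T := kuhnTriangulation d nG hnG with hT
  have e : 1 - x i = ∑ v ∈ T.vertices, T.coord v x * (1 - v i) := by
    conv_lhs => rw [← T.sum_coord_smul hx, ← T.sum_coord hx]
    simp [WithLp.ofLp_sum, mul_sub]
  rw [eq_comm, ← sub_eq_zero, e, Finset.sum_eq_zero_iff_of_nonneg fun v hv =>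
    mul_nonneg (T.coord_nonneg hx hv) (sub_nonneg.2 (mem_unitCube_of_mem_vertices hv i).2)]
  exact forall₂_congr fun v _ => by
    rw [mul_eq_zero, or_iff_not_imp_left, sub_eq_zero, eq_comm (a := (1 : ℝ))]

theorem mem_frontier_iff_of_coord {x y : Pt d} (hx : x ∈ (kuhnTriangulation d nG hnG).space)
    (hy : y ∈ (kuhnTriangulation d nG hnG).space)
    (h : ∀ v ∈ (kuhnTriangulation d nG hnG).vertices,
      (kuhnTriangulation d nG hnG).coord v x = 0 ↔ (kuhnTriangulation d nG hnG).coord v y = 0) :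
    x ∈ frontier (unitCube d) ↔ y ∈ frontier (unitCube d) := by
  have hxX : x ∈ unitCube d := kuhnTriangulation_space hnG ▸ hx
  have hyX : y ∈ unitCube d := kuhnTriangulation_space hnG ▸ hy
  rw [frontier_unitCube]
  simp only [Set.mem_ofPred_eq, hxX, hyX, true_and]
  refine exists_congr fun i => or_congr ?_ ?_
  · rw [apply_eq_zero_iff_coord hx, apply_eq_zero_iff_coord hy]
    exact forall₂_congr fun v hv => by rw [Ne, Ne, h v hv]
  · rw [apply_eq_one_iff_coord hx, apply_eq_one_iff_coord hy]
    exact forall₂_congr fun v hv => by rw [Ne, Ne, h v hv]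

theorem isManifoldWithBoundary_interpolate {n : ℕ} {𝓜 : Pt (n + 1) → SignType}
    (h𝓜 : ∀ v ∈ (kuhnTriangulation (n + 1) nG hnG).vertices, 𝓜 v ≠ 0) :
    IsManifoldWithBoundary n {x | x ∈ unitCube (n + 1) ∧
      (kuhnTriangulation (n + 1) nG hnG).interpolate (realLabel 𝓜) x = 0}
      (frontier (unitCube (n + 1))) := by
  refine isManifoldWithBoundary_zeroSet (Triangulation.continuous_interpolate _ _) ?_
  rw [← kuhnTriangulation_space hnG]
  intro x hx hx0
  refine Triangulation.exists_direction _ (fun v hv => ?_) hx hx0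
  rcases eq_neg_one_or_eq_one h𝓜 hv with h | h <;> simp [realLabel, h]

/-- Straightening restricts to a homeomorphism onto the zero set of the interpolated labels. It
preserves the vanishing of coordinates, hence the boundary of the cube. -/
theorem isManifoldWithBoundary_kResistarGrid (hd : 1 ≤ d)
    (hb : IsEdgeChoice (kuhnTriangulation d nG hnG) 𝓜 b)
    (h𝓜 : ∀ v ∈ (kuhnTriangulation d nG hnG).vertices, 𝓜 v ≠ 0) :
    IsManifoldWithBoundary (d - 1) (kResistarGrid nG 𝓜 b) (frontier (unitCube d)) := by
  obtain ⟨n, rfl⟩ : ∃ n, d = n + 1 := ⟨d - 1, by omega⟩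
  rw [Nat.add_sub_cancel]
  set T := kuhnTriangulation (n + 1) nG hnG with hT
  have hmem : ∀ x, x ∈ kResistarGrid nG 𝓜 b ↔ ∃ hx : x ∈ T.space,
      T.interpolate (realLabel 𝓜) (hb.straighten h𝓜 ⟨x, hx⟩) = 0 :=
    fun x => mem_kResistarGrid_iff hd hb h𝓜
  set Φ := hb.straighten h𝓜 with hΦ
  have hX : T.space = unitCube (n + 1) := kuhnTriangulation_space hnG
  let e : kResistarGrid nG 𝓜 b ≃ₜ
      {x | x ∈ unitCube (n + 1) ∧ T.interpolate (realLabel 𝓜) x = 0} :=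
    { toFun := fun x => ⟨Φ ⟨x, ((hmem x).1 x.2).1⟩, hX.subset (Φ _).2, ((hmem x).1 x.2).2⟩
      invFun := fun y => ⟨Φ.symm ⟨y, hX.superset y.2.1⟩, (hmem _).2 ⟨(Φ.symm _).2, by
        rw [Subtype.coe_eta, Φ.apply_symm_apply]
        exact y.2.2⟩⟩
      left_inv := fun x => Subtype.ext (by simp)
      right_inv := fun y => Subtype.ext (by simp)
      continuous_toFun := by fun_prop
      continuous_invFun := by fun_prop }
  refine (isManifoldWithBoundary_interpolate h𝓜).of_homeomorph e fun x => ?_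
  exact mem_frontier_iff_of_coord (hnG := hnG) (Φ _).2 ((hmem x).1 x.2).1 fun v hv =>
    (hb.isCentre h𝓜).coord_transfer_eq_zero_iff ((isEdgeChoice_midpoint T 𝓜).isCentre h𝓜) _ hv

end Grid

theorem mainTheorem3 (d nG : ℕ) (hd : 1 ≤ d) (hnG : 2 ≤ nG)
    (𝓜 : Pt d → SignType)
    (hgrid : ∀ m : Fin d → ℕ, (∀ i, m i < nG) → 𝓜 (gridPoint nG m) ≠ 0)
    (nₑ : Pt d → Pt d → ℕ) (b : Pt d → Pt d → Pt d)
    (hb : ∀ S ∈ kSimplices d nG, ∀ v ∈ S, ∀ w ∈ S, 𝓜 v = -1 → 𝓜 w = 1 →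
      IsBoundaryPoint 𝓜 (nₑ v w) v w (b v w)) :
    IsManifoldWithBoundary (d - 1) (kResistarGrid nG 𝓜 b) (frontier (unitCube d)) ∧
      HasConsistentCharts nG 𝓜 b := by
  have hb' : IsEdgeChoice (kuhnTriangulation d nG hnG) 𝓜 b := fun S hS v hv w hw h1 h2 =>
    (hb S hS v hv w hw h1 h2).exists_eq
  have h𝓜 : ∀ v ∈ (kuhnTriangulation d nG hnG).vertices, 𝓜 v ≠ 0 := fun v hv => by
    obtain ⟨m, hm, rfl⟩ := exists_gridPoint_of_mem_vertices hv
    exact hgrid m hm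
  exact ⟨isManifoldWithBoundary_kResistarGrid hd hb' h𝓜, hasConsistentCharts hd hb' h𝓜⟩
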